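/- **The 1G1B system.** Let $\lambda>0$, $\mu\ge 0$, $q,p\in[0,1]$, $\Gamma\ge 0$, and assume $\mu+\lambda q(1-p)>0$ (which holds whenever $\mu>0$). Let $(s(t))_{t\ge0}$ be the continuous-time Markov chain with state space $\{\emptyset,0,1,2,\dots\}$, with $s(0)=\emptyset$ and with transition rates $\lambda$ from $\emptyset$ to $0$, $\lambda qp$ from $i$ to $i+1$, and $\mu+\lambda q(1-p)$ from $i$ to $\emptyset$ ($i\ge 0$); all other transition rates are zero. If $s(t)=i\ge0$, let $\vec T(t)=(T_0(t),\dots,T_i(t))$, where, for $j<i$, $T_j(t)$ is the time spent in the most recent visit to state $j$ before $t$, and $T_i(t)$ is the time spent so far in state $i$ in the current visit. **The fidelity.** Let $\rho_{\mathrm{new}}$ be a two-qubit density matrix with fidelity $F_{\mathrm{new}}=\langle\phi^+|\rho_{\mathrm{new}}|\phi^+\rangle$, where $|\phi^+\rangle=(|00\rangle+|11\rangle)/\sqrt2$, and let $J(\cdot,\rho_{\mathrm{new}}):[0,1]\to[0,1]$ be continuous (the jump function). For $t\ge0$ put $D_t[F]=e^{-\Gamma t}\left(F-\tfrac14\right)+\tfrac14$,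 and define recursively $$F^{(0)}(t_0)=D_{t_0}[F_{\mathrm{new}}],\qquad F^{(i)}(t_0,\dots,t_i)=D_{t_i}\!\left[J\!\left(F^{(i-1)}(t_0,\dots,t_{i-1}),\rho_{\mathrm{new}}\right)\right]\quad(i\ge1).$$ Let $F(t)=F^{(i)}(\vec T(t))$ if $s(t)=i\ge0$, and $F(t)=0$ if $s(t)=\emptyset$. **Theorem.** The limits $\pi_x=\lim_{t\to\infty}P(s(t)=x)$ exist for all $x\in\{\emptyset,0,1,\dots\}$, the availability $A=1-\pi_\emptyset$ is positive, and the average consumed fidelity $\overline F=\lim_{t\to\infty}\mathbb E[F(t)\mid s(t)\ne\emptyset]$ exists and equals $$\overline F=\frac1A\sum_{i=0}^\infty c_i\,\pi_i,\qquad c_i=\mathbb E\!\left[F^{(i)}(Q_0,\dots,Q_i)\right],$$ where $Q_0,Q_1,\dots$ are i.i.d. exponential random variables with rate $\mu+\lambda q$, and the series converges. Moreover, for every $i\ge0$ with $\pi_i>0$, conditionally on $s(t)=i$, the vector $\vec T(t)$ converges in distribution to $(Q_0,\dots,Q_i)$ as $t\to\infty$. -/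

import Mathlib

open MeasureTheory ProbabilityTheory Filter Topology Set
open scoped NNReal Matrix ComplexOrder

noncomputable section

namespace Buffer

/-! ### Two-qubit states -/

/-- Operators on two qubits, in the computational basis. -/
abbrev TwoQubit : Type := Matrix (Fin 2 × Fin 2) (Fin 2 × Fin 2) ℂ

/-- `ρ` is a density matrix. -/
def IsState (ρ : TwoQubit) : Prop := ρ.PosSemidef ∧ ρ.trace = 1

/-- The Bell state `(|00⟩ + |11⟩) / √2`. -/
def phiPlus : Fin 2 × Fin 2 → ℂ := fun x => if x.1 = x.2 then ((Real.sqrt 2)⁻¹ : ℝ) else 0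

/-- Fidelity `⟨φ⁺| ρ |φ⁺⟩` of a two-qubit state with the target Bell state. -/
def fidelity (ρ : TwoQubit) : ℝ := (star phiPlus ⬝ᵥ ρ *ᵥ phiPlus).re

/-! ### Continuous-time Markov chains through jump chain and holding times -/

section CTMC

variable {S Ω : Type*}

/-- Total rate of leaving the state `x`, for the off-diagonal transition rates `r`. -/
def exitRate (r : S → S → ℝ) (x : S) : ℝ := ∑' y, r x y

/-- `s` is a continuous-time Markov chain on the countable state space `S`, started in `x₀`, with
off-diagonal transition rates `r` (where `r x x = 0` and every state has a finite positive exit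
rate). There is a jump chain `Y` and a sequence `H` of holding times: `Y` is a Markov chain started
in `x₀` that moves from `x` to `y` with probability `r x y / exitRate r x`; given `Y`, the holding
times are independent and `H k` is exponential with rate `exitRate r (Y k)`; and `s` is equal
to `Y n` from the `n`-th jump time (included) to the next one (excluded). -/
def IsCTMC [MeasurableSpace Ω] (P : Measure Ω) (r : S → S → ℝ) (x₀ : S)
    (s : ℝ≥0 → Ω → S) : Prop :=
  (∀ t x, MeasurableSet {ω | s t ω = x}) ∧
  ∃ (Y : ℕ → Ω → S) (H : ℕ → Ω → ℝ),
    (∀ n x, MeasurableSet {ω | Y n ω = x}) ∧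
    (∀ n, Measurable (H n)) ∧
    (∀ (y : ℕ → S), y 0 = x₀ → ∀ (u : ℕ → ℝ), (∀ k, 0 ≤ u k) → ∀ n : ℕ,
      P.real {ω | (∀ k ≤ n, Y k ω = y k) ∧ ∀ k < n, u k < H k ω} =
        ∏ k ∈ Finset.range n,
          Real.exp (-(exitRate r (y k) * u k)) * (r (y k) (y (k + 1)) / exitRate r (y k))) ∧
    (∀ᵐ ω ∂P, ∀ (n : ℕ) (t : ℝ≥0),
      ∑ k ∈ Finset.range n, H k ω ≤ t → t < ∑ k ∈ Finset.range (n + 1), H k ω →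
        s t ω = Y n ω)

end CTMC

/-! ### The 1G1B system -/

/-- Transition rates of the 1G1B system. The state `none` means that there is no link in memory,
`some i` that there is a link which is the result of `i` successful pumping rounds. -/
def rate (lam mu q p : ℝ) : Option ℕ → Option ℕ → ℝ
  | none, none => 0
  | none, some j => if j = 0 then lam else 0
  | some _, none => mu + lam * q * (1 - p)
  | some i, some j => if j = i + 1 then lam * q * p else 0

/-- `s` is the state process of a 1G1B system with generation rate `lam`, consumption rate `mu`,
pumping probability `q` and success probability `p`; it starts with no link. -/
def Is1G1B {Ω : Type*} [MeasurableSpace Ω] (P : Measure Ω) (lam mu q p : ℝ)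
    (s : ℝ≥0 → Ω → Option ℕ) : Prop :=
  IsCTMC P (rate lam mu q p) none s

/-- End, by time `t`, of the most recent visit of the path `f` to level `j`
(this is `t` itself if `f t = some j`). -/
def visitEnd (f : ℝ≥0 → Option ℕ) (t : ℝ≥0) (j : ℕ) : ℝ≥0 :=
  sSup {u | u ≤ t ∧ f u = some j}

/-- Beginning of the most recent visit, by time `t`, of the path `f` to level `j`. -/
def visitStart (f : ℝ≥0 → Option ℕ) (t : ℝ≥0) (j : ℕ) : ℝ≥0 :=
  sInf {u | u ≤ visitEnd f t j ∧ ∀ v, u ≤ v → v < visitEnd f t j → f v = some j}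

/-- The vector of the times spent in levels `0, …, i` during the most recent visits to them
by time `t`. -/
def levelTimes (f : ℝ≥0 → Option ℕ) (t : ℝ≥0) (i : ℕ) : Fin (i + 1) → ℝ :=
  fun j => (visitEnd f t j : ℝ) - (visitStart f t j : ℝ)

/-- Depolarising noise of rate `Γ`, acting for a time `t` on the fidelity `F`. -/
def depol (Γ t F : ℝ) : ℝ := Real.exp (-(Γ * t)) * (F - 1 / 4) + 1 / 4

/-- The fidelity of a link after it has spent the times `t 0, …, t i` in the purification levels
`0, …, i`, where `J F ρ` is the jump function of the pumping protocol. -/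
def levelFidelity (Γ : ℝ) (J : ℝ → TwoQubit → ℝ) (ρnew : TwoQubit) :
    (i : ℕ) → (Fin (i + 1) → ℝ) → ℝ
  | 0, t => depol Γ (t 0) (fidelity ρnew)
  | i + 1, t =>
      depol Γ (t (Fin.last (i + 1)))
        (J (levelFidelity Γ J ρnew i (fun j => t j.castSucc)) ρnew)

/-- The fidelity at time `t` of the system that follows the path `f`. -/
def pathFidelity (Γ : ℝ) (J : ℝ → TwoQubit → ℝ) (ρnew : TwoQubit)
    (f : ℝ≥0 → Option ℕ) (t : ℝ≥0) : ℝ :=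
  match f t with
  | none => 0
  | some i => levelFidelity Γ J ρnew i (levelTimes f t i)

/-- The joint law of `i + 1` independent exponential random variables of rate `a`. -/
def iidExp (a : ℝ) (i : ℕ) : Measure (Fin (i + 1) → ℝ) :=
  Measure.pi fun _ => expMeasure a

end Buffer

end

/-!
Write `β` for the rate `mu + lam * q * (1 - p)` of losing a link. Everything rests on a
decomposition at the last jump. The age of the current visit and the last completed holding time are
consecutive exponential clocks with a given sum, so up to the ratio of their rates the pair may be
read in either order. Summed over the number of jumps, this expresses the law of the process in a
state `z` at time `t` through its law in the predecessors of `z` at time `t - v`, where `v` is an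
exponential variable of rate `exitRate z`.

* For `z = none`, which is entered at rate `β` from all other states, the probability `p₀` of `none`
  satisfies `p₀ t = exp (-lam * t) + β * ∫ u in 0..t, exp (-lam * (t - u)) * (1 - p₀ u)`, whence
  `p₀ t = π₀ + (1 - π₀) * exp (-(lam + β) * t)` with `π₀ = β / (lam + β)`.
* For `z = some i`, which has a single predecessor, induction on `i` shows that the level times on
  the event `s t = some i` have density `x ↦ w i * p₀ (t - ∑ j, x j)` with respect to independent
  exponential variables of rate `mu + lam * q`, where `w` is a geometric sequence of sum `lam / β`.

As `t → ∞` the density tends to the constant `w i * π₀`, and all limits follow by dominated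
convergence, the sum over the levels being dominated by `w`.
-/

namespace Buffer

/-! ### Vectors of real numbers -/

@[fun_prop]
lemma measurable_snoc {α : Type*} [MeasurableSpace α] {n : ℕ} {f : α → Fin n → ℝ} {g : α → ℝ}
    (hf : Measurable f) (hg : Measurable g) :
    Measurable fun a => (Fin.snoc (f a) (g a) : Fin (n + 1) → ℝ) := by
  refine measurable_pi_iff.2 fun j => ?_
  induction j using Fin.lastCases with
  | last => simpa using hg
  | cast j => simpa [Function.comp_def] using (measurable_pi_apply j).comp hf

lemma lintegral_pi_snoc {n : ℕ} (μ : Fin (n + 1) → Measure ℝ) [∀ k, SigmaFinite (μ k)]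
    {g : (Fin (n + 1) → ℝ) → ENNReal} (hg : Measurable g) :
    ∫⁻ x, g x ∂(Measure.pi μ) = ∫⁻ w, g (Fin.snoc w.2 w.1)
      ∂((μ (Fin.last n)).prod (Measure.pi fun k : Fin n => μ k.castSucc)) := by
  have hsplit := (measurePreserving_piFinSuccAbove μ (Fin.last n)).symm.lintegral_comp hg
  simp only [Fin.succAbove_last] at hsplit
  rw [← hsplit]
  exact lintegral_congr fun w => congrArg g (Fin.insertNth_last' w.1 w.2)

lemma measure_ext_pi_Ioi {ι : Type*} [Finite ι] {μ ν : Measure (ι → ℝ)} [IsFiniteMeasure μ]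
    (h : ∀ u : ι → ℝ, μ (univ.pi fun i => Ioi (u i)) = ν (univ.pi fun i => Ioi (u i))) :
    μ = ν := by
  have hcover : ⋃ k : ℕ, Ioi (-(k : ℝ)) = univ := by
    refine eq_univ_of_forall fun x => mem_iUnion.2 ?_
    obtain ⟨k, hk⟩ := exists_nat_gt (-x)
    exact ⟨k, neg_lt.1 hk⟩
  have hspan : IsCountablySpanning (range (Ioi : ℝ → Set ℝ)) :=
    ⟨fun k : ℕ => Ioi (-(k : ℝ)), fun k => mem_range_self _, hcover⟩
  refine Measure.ext_of_generateFrom_of_iUnion _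
    (fun k : ℕ => univ.pi fun _ => Ioi (-(k : ℝ))) ?_ (IsPiSystem.pi fun _ => isPiSystem_Ioi)
    ?_ (fun k => mem_image_of_mem _ fun _ _ => mem_range_self _) (fun k => measure_ne_top μ _) ?_
  · rw [← generateFrom_pi_eq fun _ : ι => hspan, ← borel_eq_generateFrom_Ioi,
      ← BorelSpace.measurable_eq (α := ℝ)]
  · rw [iUnion_univ_pi_of_monotone fun _ => fun k l hkl => Ioi_subset_Ioi (by simpa using hkl)]
    simp only [hcover, pi_univ]
  · rintro _ ⟨c, hc, rfl⟩
    choose u hu using fun i => hc i (mem_univ i)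
    simpa only [hu] using h u

/-- The last `i` entries of the vector `x`; only the case `i ≤ n` is meaningful. -/
def lastEntries : (i : ℕ) → {n : ℕ} → (Fin n → ℝ) → Fin i → ℝ
  | 0, _, _ => Fin.elim0
  | _ + 1, 0, _ => 0
  | i + 1, _ + 1, x => Fin.snoc (lastEntries i (Fin.init x)) (x (Fin.last _))

@[fun_prop]
lemma measurable_lastEntries (i : ℕ) {n : ℕ} : Measurable (lastEntries i (n := n)) := by
  induction i generalizing n with
  | zero => exact measurable_const
  | succ i ih =>
    cases n with
    | zero => exact measurable_const
    | succ n =>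
      have hinit : Measurable fun x : Fin (n + 1) → ℝ => lastEntries i (Fin.init x) :=
        ih.comp (measurable_pi_lambda _ fun k => measurable_pi_apply k.castSucc)
      exact measurable_snoc hinit (measurable_pi_apply _)

lemma lastEntries_apply {m i : ℕ} (x : Fin (m + i) → ℝ) (j : Fin i) :
    lastEntries i x j = x (Fin.natAdd m j) := by
  induction i with
  | zero => exact j.elim0
  | succ i ih =>
    change (Fin.snoc (lastEntries i (Fin.init x)) (x (Fin.last _)) : Fin (i + 1) → ℝ) j = _
    induction j using Fin.lastCases with
    | last => exact Fin.snoc_last _ _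
    | cast j => exact (Fin.snoc_castSucc (α := fun _ => ℝ) _ _ _).trans (ih _ j)

/-! ### Exponential clocks -/

lemma expMeasure_Ioi {e : ℝ} (he : 0 < e) (u : ℝ) :
    expMeasure e (Ioi u) = ENNReal.ofReal (Real.exp (-(e * max u 0))) := by
  have := isProbabilityMeasure_expMeasure he
  rw [← ofReal_measureReal, ← compl_Iic, probReal_compl_eq_one_sub measurableSet_Iic, ← cdf_eq_real,
    cdf_expMeasure_eq he]
  split_ifs with hu
  · rw [max_eq_left hu, sub_sub_cancel]
  · rw [max_eq_right (not_le.1 hu).le, mul_zero, neg_zero, Real.exp_zero, sub_zero]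

/-- Probability that an exponential clock of rate `e` started at time `0` has not rung at
time `τ`, set to `0` when the clock has not been started yet (`τ < 0`). With this convention it is
also, up to the factor `e`, the density of the clock. -/
noncomputable def survival (e τ : ℝ) : ENNReal :=
  if 0 ≤ τ then ENNReal.ofReal (Real.exp (-(e * τ))) else 0

@[fun_prop]
lemma measurable_survival {α : Type*} [MeasurableSpace α] {e τ : α → ℝ} (he : Measurable e)
    (hτ : Measurable τ) : Measurable fun a => survival (e a) (τ a) :=
  Measurable.ite (measurableSet_le measurable_const hτ) (by fun_prop) measurable_const

lemma exponentialPDF_eq_survival {e : ℝ} (he : 0 < e) (x : ℝ) :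
    exponentialPDF e x = ENNReal.ofReal e * survival e x := by
  rw [exponentialPDF_eq, survival]
  split_ifs with hx
  · rw [ENNReal.ofReal_mul he.le]
  · rw [ENNReal.ofReal_zero, mul_zero]

lemma lintegral_expMeasure {e : ℝ} (he : 0 < e) {f : ℝ → ENNReal} (hf : Measurable f) :
    ∫⁻ x, f x ∂(expMeasure e) = ENNReal.ofReal e * ∫⁻ x, survival e x * f x := by
  have hpdf : exponentialPDF e = fun x => ENNReal.ofReal e * survival e x :=
    funext (exponentialPDF_eq_survival he)
  have hdensity : expMeasure e = volume.withDensity (exponentialPDF e) := rfl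
  rw [hdensity, hpdf, lintegral_withDensity_eq_lintegral_mul _ (by fun_prop) hf,
    ← lintegral_const_mul _ (by fun_prop)]
  simp only [Pi.mul_apply, mul_assoc]

-- Two consecutive clocks with total age `τ`, parametrised by the first duration or by the second.
lemma lintegral_expMeasure_swap {e e' c : ℝ} (he : 0 < e) (he' : 0 < e') (hc : 0 ≤ c) (τ : ℝ)
    {f : ℝ × ℝ → ENNReal} (hf : Measurable f) :
    ENNReal.ofReal (c / e) * ∫⁻ s, survival e' (τ - s) * f (s, τ - s) ∂(expMeasure e) =
      ∫⁻ v, survival e (τ - v) * (ENNReal.ofReal (c / e') * f (τ - v, v)) ∂(expMeasure e') := by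
  have hcancel : ∀ {a : ℝ} (I : ENNReal), 0 < a →
      ENNReal.ofReal (c / a) * (ENNReal.ofReal a * I) = ENNReal.ofReal c * I := fun I ha => by
    rw [← mul_assoc, ← ENNReal.ofReal_mul (by positivity), div_mul_cancel₀ c ha.ne']
  simp only [mul_left_comm (survival _ _)]
  rw [lintegral_const_mul _ (by fun_prop), lintegral_expMeasure he (by fun_prop),
    lintegral_expMeasure he' (by fun_prop), hcancel _ he, hcancel _ he',
    ← lintegral_sub_left_eq_self (fun s => survival e s * _) τ]
  congr 1
  refine lintegral_congr fun v => ?_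
  rw [sub_sub_cancel, mul_left_comm]

lemma lintegral_exp_neg_expMeasure {e : ℝ} (he : 0 < e) :
    ∫⁻ x, ENNReal.ofReal (Real.exp (-x)) ∂(expMeasure e) = ENNReal.ofReal (e / (e + 1)) := by
  have he1 : 0 < e + 1 := by linarith
  have hmerge : ∀ x, survival e x * ENNReal.ofReal (Real.exp (-x)) = survival (e + 1) x := by
    intro x
    unfold survival
    split_ifs
    · rw [← ENNReal.ofReal_mul (Real.exp_pos _).le, ← Real.exp_add]
      ring_nf
    · exact zero_mul _
  have htotal : ENNReal.ofReal (e + 1) * ∫⁻ x, survival (e + 1) x = 1 := by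
    rw [← lintegral_const_mul _ (by fun_prop), ← lintegral_exponentialPDF_eq_one he1]
    simp only [exponentialPDF_eq_survival he1]
  rw [lintegral_expMeasure he (by fun_prop)]
  simp only [hmerge]
  rw [div_eq_mul_inv, ENNReal.ofReal_mul he.le, ENNReal.ofReal_inv_of_pos he1,
    ENNReal.eq_inv_of_mul_eq_one_left ((mul_comm _ _).trans htotal)]

lemma expMeasure_window {e : ℝ} (he : 0 < e) (a t : ℝ) :
    expMeasure e {s | a ≤ t ∧ t < a + s} = survival e (t - a) := by
  unfold survival
  split_ifs with hat
  · rw [← max_eq_left hat, ← expMeasure_Ioi he]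
    congr 1
    ext s
    simp only [mem_ofPred_eq, sub_nonneg.1 hat, true_and, mem_Ioi, sub_lt_iff_lt_add']
  · rw [sub_nonneg] at hat
    simp only [hat, false_and, ofPred_false, measure_empty]

lemma isProbabilityMeasure_iidExp {a : ℝ} (ha : 0 < a) (i : ℕ) :
    IsProbabilityMeasure (iidExp a i) := by
  have := isProbabilityMeasure_expMeasure ha
  unfold iidExp
  infer_instance

lemma ae_iidExp_nonneg {a : ℝ} (ha : 0 < a) (i : ℕ) : ∀ᵐ x ∂(iidExp a i), 0 ≤ x := by
  have := isProbabilityMeasure_expMeasure ha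
  have hpos : ∀ᵐ y ∂(expMeasure a), 0 ≤ y := by
    refine (mem_ae_iff_prob_eq_one measurableSet_Ici).2 (le_antisymm prob_le_one ?_)
    refine le_trans (le_of_eq ?_) (measure_mono Ioi_subset_Ici_self)
    simp [expMeasure_Ioi ha]
  exact ae_all_iff.2 fun j => Measure.tendsto_eval_ae_ae.eventually hpos

lemma lintegral_iidExp_zero {a : ℝ} (ha : 0 < a) {g : (Fin 1 → ℝ) → ENNReal} (hg : Measurable g) :
    ∫⁻ x, g x ∂(iidExp a 0) = ∫⁻ v, g (Fin.snoc Fin.elim0 v) ∂(expMeasure a) := by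
  have := isProbabilityMeasure_expMeasure ha
  rw [iidExp, lintegral_pi_snoc _ hg, lintegral_prod _ (by fun_prop)]
  simp [Measure.pi_of_empty _ Fin.elim0]

lemma lintegral_iidExp_succ {a : ℝ} (ha : 0 < a) (i : ℕ) {g : (Fin (i + 2) → ℝ) → ENNReal}
    (hg : Measurable g) : ∫⁻ x, g x ∂(iidExp a (i + 1)) =
      ∫⁻ v, ∫⁻ x, g (Fin.snoc x v) ∂(iidExp a i) ∂(expMeasure a) := by
  have := isProbabilityMeasure_expMeasure ha
  rw [iidExp, lintegral_pi_snoc _ hg, lintegral_prod _ (by fun_prop)]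
  rfl

/-! ### Jump chain and holding times -/

section JumpChain

variable {S Ω : Type*}

/-- `Y` is the jump chain and `H` the sequence of holding times of a continuous-time Markov chain
with rates `r` started in `x₀`: the data provided by `IsCTMC`, without the path. -/
structure IsJumpHold [MeasurableSpace S] [MeasurableSpace Ω] (P : Measure Ω) (r : S → S → ℝ)
    (x₀ : S) (Y : ℕ → Ω → S) (H : ℕ → Ω → ℝ) : Prop where
  rate_nonneg : ∀ x y, 0 ≤ r x y
  exitRate_pos : ∀ x, 0 < exitRate r x
  measurable_state : ∀ n, Measurable (Y n)
  measurable_hold : ∀ n, Measurable (H n)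
  law : ∀ (y : ℕ → S), y 0 = x₀ → ∀ (u : ℕ → ℝ), (∀ k, 0 ≤ u k) → ∀ n : ℕ,
    P.real {ω | (∀ k ≤ n, Y k ω = y k) ∧ ∀ k < n, u k < H k ω} =
      ∏ k ∈ Finset.range n,
        Real.exp (-(exitRate r (y k) * u k)) * (r (y k) (y (k + 1)) / exitRate r (y k))

/-- The event that the first `n` jumps follow the path `y`. -/
def pathEvent (Y : ℕ → Ω → S) (n : ℕ) (y : ℕ → S) : Set Ω :=
  {ω | ∀ k ≤ n, Y k ω = y k}

/-- Probability that the first `n` jumps of the chain started in `y 0` follow the path `y`. -/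
noncomputable def pathWeight (r : S → S → ℝ) (n : ℕ) (y : ℕ → S) : ℝ :=
  ∏ k ∈ Finset.range n, r (y k) (y (k + 1)) / exitRate r (y k)

/-- The states visited up to the `n`-th jump, and the holding times in all of them but the last. -/
def trajectory (Y : ℕ → Ω → S) (H : ℕ → Ω → ℝ) (n : ℕ) (ω : Ω) :
    (Fin (n + 1) → S) × (Fin n → ℝ) :=
  (fun k => Y k ω, fun k => H k ω)

/-- The `n`-th jump time. -/
def jumpTime (H : ℕ → Ω → ℝ) (n : ℕ) (ω : Ω) : ℝ := ∑ k ∈ Finset.range n, H k ω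

/-- The event that exactly `n` jumps have occurred by time `t`. -/
def window (H : ℕ → Ω → ℝ) (n : ℕ) (t : ℝ) : Set Ω :=
  {ω | jumpTime H n ω ≤ t ∧ t < jumpTime H (n + 1) ω}

lemma jumpTime_succ (H : ℕ → Ω → ℝ) (n : ℕ) (ω : Ω) :
    jumpTime H (n + 1) ω = jumpTime H n ω + H n ω :=
  Finset.sum_range_succ _ _

lemma sum_trajectory_snd (Y : ℕ → Ω → S) (H : ℕ → Ω → ℝ) (n : ℕ) (ω : Ω) :
    ∑ k, (trajectory Y H n ω).2 k = jumpTime H n ω :=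
  Fin.sum_univ_eq_sum_range (fun k => H k ω) n

lemma pathEvent_update_succ (Y : ℕ → Ω → S) (n : ℕ) (y : ℕ → S) (z : S) :
    pathEvent Y (n + 1) (Function.update y (n + 1) z) = pathEvent Y n y ∩ Y (n + 1) ⁻¹' {z} := by
  ext ω
  simp only [pathEvent, mem_ofPred_eq, Nat.le_succ_iff, or_imp, forall_and, forall_eq,
    Function.update_self, mem_inter_iff, mem_preimage, mem_singleton_iff]
  refine and_congr_left fun _ => forall₂_congr fun k hk => ?_
  rw [Function.update_of_ne (by omega)]

lemma pathWeight_update_succ (r : S → S → ℝ) (n : ℕ) (y : ℕ → S) (z : S) :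
    pathWeight r (n + 1) (Function.update y (n + 1) z) =
      pathWeight r n y * (r (y n) z / exitRate r (y n)) := by
  rw [pathWeight, Finset.prod_range_succ, Function.update_self,
    Function.update_of_ne (Nat.lt_succ_self n).ne]
  congr 1
  refine Finset.prod_congr rfl fun k hk => ?_
  have hk := Finset.mem_range.1 hk
  rw [Function.update_of_ne (by omega), Function.update_of_ne (by omega)]

lemma tsum_ofReal_rate_div {r : S → S → ℝ} {x : S} (he : 0 < exitRate r x)
    (hr : ∀ y, 0 ≤ r x y) : ∑' z, ENNReal.ofReal (r x z / exitRate r x) = 1 := by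
  have hsum : Summable (r x) := by
    by_contra hcon
    exact he.ne' (tsum_eq_zero_of_not_summable hcon)
  rw [← ENNReal.ofReal_tsum_of_nonneg (fun z => div_nonneg (hr z) he.le) (hsum.div_const _),
    tsum_div_const, ← exitRate, div_self he.ne', ENNReal.ofReal_one]

variable [MeasurableSpace S] [MeasurableSpace Ω]

lemma lintegral_eq_tsum_fiber [Countable S] [MeasurableSingletonClass S] (P : Measure Ω)
    {Z : Ω → S} (hZ : Measurable Z) (f : Ω → ENNReal) :
    ∫⁻ ω, f ω ∂P = ∑' x, ∫⁻ ω in Z ⁻¹' {x}, f ω ∂P := by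
  rw [← lintegral_iUnion (fun x => hZ (measurableSet_singleton x))
    fun x y hxy => (disjoint_singleton.2 hxy).preimage Z, ← preimage_iUnion,
    iUnion_of_singleton, preimage_univ, setLIntegral_univ]

namespace IsJumpHold

variable {P : Measure Ω} {r : S → S → ℝ} {x₀ : S} {Y : ℕ → Ω → S} {H : ℕ → Ω → ℝ}

lemma pathWeight_nonneg (h : IsJumpHold P r x₀ Y H) (n : ℕ) (y : ℕ → S) :
    0 ≤ pathWeight r n y :=
  Finset.prod_nonneg fun _ _ => div_nonneg (h.rate_nonneg _ _) (h.exitRate_pos _).le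

lemma measurable_trajectory (h : IsJumpHold P r x₀ Y H) (n : ℕ) :
    Measurable (trajectory Y H n) :=
  Measurable.prodMk (measurable_pi_iff.2 fun k => h.measurable_state k)
    (measurable_pi_iff.2 fun k => h.measurable_hold k)

lemma measurable_jumpTime (h : IsJumpHold P r x₀ Y H) (n : ℕ) : Measurable (jumpTime H n) :=
  Finset.measurable_fun_sum _ fun k _ => h.measurable_hold k

lemma measurableSet_window (h : IsJumpHold P r x₀ Y H) (n : ℕ) (t : ℝ) :
    MeasurableSet (window H n t) :=
  (measurableSet_le (h.measurable_jumpTime n) measurable_const).inter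
    (measurableSet_lt measurable_const (h.measurable_jumpTime (n + 1)))

lemma measurableSet_window_prod (h : IsJumpHold P r x₀ Y H) (n : ℕ) :
    MeasurableSet {w : ℝ × Ω | w.2 ∈ window H n w.1} :=
  (measurableSet_le ((h.measurable_jumpTime n).comp measurable_snd) measurable_fst).inter
    (measurableSet_lt measurable_fst ((h.measurable_jumpTime (n + 1)).comp measurable_snd))

lemma measurable_setLIntegral_window [SFinite P] (h : IsJumpHold P r x₀ Y H) {A : Set S}
    (hA : MeasurableSet A) (n : ℕ) {f : ℝ × Ω → ENNReal} (hf : Measurable f) :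
    Measurable fun t => ∫⁻ ω in Y n ⁻¹' A ∩ window H n t, f (t, ω) ∂P := by
  have hset : MeasurableSet {w : ℝ × Ω | w.2 ∈ Y n ⁻¹' A ∩ window H n w.1} :=
    (measurable_snd (h.measurable_state n hA)).inter (h.measurableSet_window_prod n)
  simp only [← lintegral_indicator ((h.measurable_state n hA).inter (h.measurableSet_window n _))]
  exact (hf.indicator hset).lintegral_prod_right'

lemma measurable_measure_window [SFinite P] (h : IsJumpHold P r x₀ Y H) {A : Set S}
    (hA : MeasurableSet A) (n : ℕ) : Measurable fun t => P (Y n ⁻¹' A ∩ window H n t) := by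
  simpa only [Pi.one_apply, setLIntegral_one] using
    h.measurable_setLIntegral_window hA n measurable_one

lemma measure_pathEvent_inter_hold_pos [IsFiniteMeasure P] (h : IsJumpHold P r x₀ Y H)
    (n : ℕ) {y : ℕ → S} (hy : y 0 = x₀) :
    P (pathEvent Y n y ∩ {ω | ∀ k < n, 0 < H k ω}) = ENNReal.ofReal (pathWeight r n y) := by
  rw [← ofReal_measureReal]
  refine congrArg _ ((h.law y hy (fun _ => 0) (fun _ => le_rfl) n).trans ?_)
  simp only [mul_zero, neg_zero, Real.exp_zero, one_mul, pathWeight]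

variable [MeasurableSingletonClass S]

lemma measurableSet_pathEvent (h : IsJumpHold P r x₀ Y H) (n : ℕ) (y : ℕ → S) :
    MeasurableSet (pathEvent Y n y) := by
  simp only [pathEvent, ofPred_forall]
  exact .iInter fun k => .iInter fun _ => h.measurable_state k (measurableSet_singleton (y k))

lemma ae_start [IsProbabilityMeasure P] (h : IsJumpHold P r x₀ Y H) : ∀ᵐ ω ∂P, Y 0 ω = x₀ := by
  have hlaw : P.real {ω | Y 0 ω = x₀} = 1 := by
    simpa using h.law (fun _ => x₀) rfl 0 (fun _ => le_rfl) 0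
  rw [measureReal_def, ENNReal.toReal_eq_one_iff] at hlaw
  exact (prob_compl_eq_zero_iff (h.measurable_state 0 (measurableSet_singleton x₀))).2 hlaw

variable [Countable S]

lemma measure_pathEvent_inter (h : IsJumpHold P r x₀ Y H) (n : ℕ) (y : ℕ → S) (A : Set Ω) :
    P (pathEvent Y n y ∩ A) =
      ∑' z, P (pathEvent Y (n + 1) (Function.update y (n + 1) z) ∩ A) := by
  have hfibers := lintegral_eq_tsum_fiber (P.restrict (pathEvent Y n y ∩ A))
    (h.measurable_state (n + 1)) 1
  simp only [Pi.one_apply, lintegral_one, Measure.restrict_apply_univ] at hfibers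
  refine hfibers.trans (tsum_congr fun z => ?_)
  rw [Measure.restrict_apply (h.measurable_state (n + 1) (measurableSet_singleton z)),
    pathEvent_update_succ, inter_comm, inter_right_comm]

variable [IsProbabilityMeasure P]

lemma lintegral_congr_path (h : IsJumpHold P r x₀ Y H) (n : ℕ) {f g : Ω → ENNReal}
    (hfg : ∀ y : ℕ → S, y 0 = x₀ →
      ∫⁻ ω in pathEvent Y n y, f ω ∂P = ∫⁻ ω in pathEvent Y n y, g ω ∂P) :
    ∫⁻ ω, f ω ∂P = ∫⁻ ω, g ω ∂P := by
  have hstates : Measurable fun ω => (trajectory Y H n ω).1 := (h.measurable_trajectory n).fst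
  rw [lintegral_eq_tsum_fiber P hstates f, lintegral_eq_tsum_fiber P hstates g]
  refine tsum_congr fun x => ?_
  let y : ℕ → S := fun k => x (Fin.ofNat (n + 1) k)
  have hy : (fun ω => (trajectory Y H n ω).1) ⁻¹' {x} = pathEvent Y n y := by
    ext ω
    refine funext_iff.trans ⟨fun hω k hk => ?_, fun hω k => ?_⟩
    · simpa [trajectory, y, Nat.mod_eq_of_lt (Nat.lt_succ_of_le hk)] using hω (Fin.ofNat (n + 1) k)
    · simpa [trajectory, y] using hω k k.is_le
  rw [hy]
  by_cases hx : y 0 = x₀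
  · exact hfg y hx
  · have hnull : P (pathEvent Y n y) = 0 :=
      measure_mono_null (fun ω hω h0 => hx ((hω 0 n.zero_le).symm.trans h0)) (ae_iff.1 h.ae_start)
    rw [setLIntegral_measure_zero _ _ hnull, setLIntegral_measure_zero _ _ hnull]

lemma measure_hold_pos_succ (h : IsJumpHold P r x₀ Y H) (n : ℕ) :
    P {ω | ∀ k < n + 1, 0 < H k ω} = P {ω | ∀ k < n, 0 < H k ω} := by
  have hmeas : ∀ n, MeasurableSet {ω | ∀ k < n, 0 < H k ω} := fun n => by
    simp only [ofPred_forall]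
    exact .iInter fun k => .iInter fun _ => measurableSet_lt measurable_const (h.measurable_hold k)
  rw [← lintegral_indicator_one (hmeas _), ← lintegral_indicator_one (hmeas _)]
  refine h.lintegral_congr_path n fun y hy => ?_
  rw [lintegral_indicator_one (hmeas _), lintegral_indicator_one (hmeas _),
    Measure.restrict_apply' (h.measurableSet_pathEvent n y),
    Measure.restrict_apply' (h.measurableSet_pathEvent n y), inter_comm, inter_comm {ω | _},
    h.measure_pathEvent_inter_hold_pos n hy, h.measure_pathEvent_inter]
  calc ∑' z, P (pathEvent Y (n + 1) (Function.update y (n + 1) z) ∩ {ω | ∀ k < n + 1, 0 < H k ω})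
    _ = ∑' z, ENNReal.ofReal (pathWeight r n y) *
          ENNReal.ofReal (r (y n) z / exitRate r (y n)) := tsum_congr fun z => by
        rw [h.measure_pathEvent_inter_hold_pos (n + 1) (by simpa using hy), pathWeight_update_succ,
          ENNReal.ofReal_mul (h.pathWeight_nonneg n y)]
    _ = ENNReal.ofReal (pathWeight r n y) := by
        rw [ENNReal.tsum_mul_left, tsum_ofReal_rate_div (h.exitRate_pos _) (h.rate_nonneg _),
          mul_one]

lemma ae_hold_pos (h : IsJumpHold P r x₀ Y H) : ∀ᵐ ω ∂P, ∀ n, 0 < H n ω := by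
  have hprob : ∀ n, P {ω | ∀ k < n, 0 < H k ω} = 1 := fun n => by
    induction n with
    | zero => simp
    | succ n ih => rw [h.measure_hold_pos_succ, ih]
  have hmeas : ∀ n, MeasurableSet {ω | 0 < H n ω} :=
    fun n => measurableSet_lt measurable_const (h.measurable_hold n)
  refine ae_all_iff.2 fun n => (prob_compl_eq_zero_iff (hmeas n)).2 (le_antisymm prob_le_one ?_)
  exact (hprob (n + 1)).ge.trans (measure_mono fun ω hω => hω n n.lt_succ_self)

lemma measure_pathEvent_inter_lt_hold (h : IsJumpHold P r x₀ Y H) (n : ℕ) {y : ℕ → S}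
    (hy : y 0 = x₀) (u : ℕ → ℝ) :
    P (pathEvent Y n y ∩ {ω | ∀ k < n, u k < H k ω}) =
      ENNReal.ofReal (pathWeight r n y) *
        ∏ k ∈ Finset.range n, expMeasure (exitRate r (y k)) (Ioi (u k)) := by
  have hae : (pathEvent Y n y ∩ {ω | ∀ k < n, u k < H k ω} : Set Ω)
      =ᵐ[P] {ω | (∀ k ≤ n, Y k ω = y k) ∧ ∀ k < n, max (u k) 0 < H k ω} := by
    filter_upwards [h.ae_hold_pos] with ω hω
    refine propext (and_congr_right fun _ => forall₂_congr fun k _ => ?_)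
    rw [max_lt_iff, and_iff_left (hω k)]
  rw [measure_congr hae, ← ofReal_measureReal, h.law y hy _ (fun k => le_max_right _ _) n,
    Finset.prod_mul_distrib, mul_comm, ← pathWeight, ENNReal.ofReal_mul (h.pathWeight_nonneg n y),
    ENNReal.ofReal_prod_of_nonneg fun _ _ => (Real.exp_pos _).le]
  simp only [expMeasure_Ioi (h.exitRate_pos _)]

lemma map_hold_restrict_pathEvent (h : IsJumpHold P r x₀ Y H) (n : ℕ) {y : ℕ → S}
    (hy : y 0 = x₀) :
    (P.restrict (pathEvent Y n y)).map (fun ω => (trajectory Y H n ω).2) =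
      ENNReal.ofReal (pathWeight r n y) •
        Measure.pi fun k : Fin n => expMeasure (exitRate r (y k)) := by
  have hprob : ∀ k : Fin n, IsProbabilityMeasure (expMeasure (exitRate r (y k))) :=
    fun k => isProbabilityMeasure_expMeasure (h.exitRate_pos _)
  have hmeas := (h.measurable_trajectory n).snd
  refine measure_ext_pi_Ioi fun u => ?_
  obtain ⟨u, rfl⟩ : ∃ u' : ℕ → ℝ, u = fun k : Fin n => u' k :=
    ⟨fun k => if hk : k < n then u ⟨k, hk⟩ else 0, by simp⟩
  have hevent : (fun ω => (trajectory Y H n ω).2) ⁻¹' (univ.pi fun k : Fin n => Ioi (u k)) =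
      {ω | ∀ k < n, u k < H k ω} := by
    ext ω
    simp only [trajectory, mem_preimage, mem_univ_pi, mem_Ioi, Fin.forall_iff, mem_ofPred_eq]
  rw [Measure.map_apply hmeas (.univ_pi fun _ => measurableSet_Ioi),
    Measure.restrict_apply' (h.measurableSet_pathEvent n y), hevent, inter_comm,
    h.measure_pathEvent_inter_lt_hold n hy, Measure.smul_apply, Measure.pi_pi, smul_eq_mul,
    Fin.prod_univ_eq_prod_range (fun k => expMeasure (exitRate r (y k)) (Ioi (u k)))]

lemma lintegral_pathEvent (h : IsJumpHold P r x₀ Y H) (n : ℕ) {y : ℕ → S} (hy : y 0 = x₀)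
    {f : (Fin (n + 1) → S) × (Fin n → ℝ) → ENNReal} (hf : Measurable f) :
    ∫⁻ ω in pathEvent Y n y, f (trajectory Y H n ω) ∂P =
      ENNReal.ofReal (pathWeight r n y) *
        ∫⁻ x, f (fun k => y k, x) ∂(Measure.pi fun k : Fin n => expMeasure (exitRate r (y k))) := by
  have hpath : EqOn (fun ω => f (trajectory Y H n ω))
      (fun ω => f (fun k => y k, (trajectory Y H n ω).2)) (pathEvent Y n y) := fun ω hω => by
    have hstates : (trajectory Y H n ω).1 = fun k : Fin (n + 1) => y k :=
      funext fun k : Fin (n + 1) => hω k k.is_le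
    simp only [← hstates]
  rw [setLIntegral_congr_fun (h.measurableSet_pathEvent n y) hpath,
    ← lintegral_map (f := fun x => f (fun k => y k, x)) (by fun_prop)
      (h.measurable_trajectory n).snd,
    h.map_hold_restrict_pathEvent n hy, lintegral_smul_measure, smul_eq_mul]

lemma lintegral_pathEvent_inter (h : IsJumpHold P r x₀ Y H) (n : ℕ) (z : S) {y : ℕ → S}
    (hy : y 0 = x₀) {f : ((Fin (n + 1) → S) × (Fin n → ℝ)) × ℝ → ENNReal} (hf : Measurable f) :
    ∫⁻ ω in pathEvent Y n y ∩ Y (n + 1) ⁻¹' {z}, f (trajectory Y H n ω, H n ω) ∂P =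
      ENNReal.ofReal (r (y n) z / exitRate r (y n)) * ∫⁻ ω in pathEvent Y n y,
        ∫⁻ s, f (trajectory Y H n ω, s) ∂(expMeasure (exitRate r (y n))) ∂P := by
  set y' := Function.update y (n + 1) z with hy'
  have hinit : ∀ k ≤ n, y' k = y k := fun k hk => Function.update_of_ne (by omega) _ _
  have hprob : ∀ x, IsProbabilityMeasure (expMeasure (exitRate r x)) :=
    fun x => isProbabilityMeasure_expMeasure (h.exitRate_pos x)
  have hlast := h.lintegral_pathEvent (n + 1) (y := y') ((hinit 0 n.zero_le).trans hy)
    (f := fun w => f ((fun k => w.1 k.castSucc, fun k => w.2 k.castSucc), w.2 (Fin.last n)))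
    (by fun_prop)
  rw [lintegral_pi_snoc _ (by fun_prop), lintegral_prod_symm' _ (by fun_prop)] at hlast
  simp only [Fin.snoc_last, Fin.snoc_castSucc, Fin.val_castSucc, Fin.val_last, hinit _ le_rfl,
    fun k : Fin n => hinit k k.is_lt.le, fun k : Fin (n + 1) => hinit k k.is_le] at hlast
  rw [← pathEvent_update_succ, ← hy', h.lintegral_pathEvent n hy hf.lintegral_prod_right',
    mul_left_comm, ← mul_assoc, ← ENNReal.ofReal_mul (h.pathWeight_nonneg n y),
    ← pathWeight_update_succ]
  exact hlast

lemma lintegral_step (h : IsJumpHold P r x₀ Y H) (n : ℕ) (z : S)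
    {f : ((Fin (n + 1) → S) × (Fin n → ℝ)) × ℝ → ENNReal} (hf : Measurable f) :
    ∫⁻ ω in Y (n + 1) ⁻¹' {z}, f (trajectory Y H n ω, H n ω) ∂P =
      ∫⁻ ω, ENNReal.ofReal (r (Y n ω) z / exitRate r (Y n ω)) *
        ∫⁻ s, f (trajectory Y H n ω, s) ∂(expMeasure (exitRate r (Y n ω))) ∂P := by
  have hz : MeasurableSet (Y (n + 1) ⁻¹' {z}) :=
    h.measurable_state (n + 1) (measurableSet_singleton z)
  rw [← lintegral_indicator hz]
  refine h.lintegral_congr_path n fun y hy => ?_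
  have := isProbabilityMeasure_expMeasure (h.exitRate_pos (y n))
  have hmeas : Measurable fun ω =>
      ∫⁻ s, f (trajectory Y H n ω, s) ∂(expMeasure (exitRate r (y n))) :=
    hf.lintegral_prod_right'.comp (h.measurable_trajectory n)
  rw [lintegral_indicator hz, Measure.restrict_restrict hz, inter_comm,
    h.lintegral_pathEvent_inter n z hy hf, ← lintegral_const_mul _ hmeas]
  exact setLIntegral_congr_fun (h.measurableSet_pathEvent n y) fun ω hω => by
    simp only [hω n le_rfl]

lemma lintegral_hold (h : IsJumpHold P r x₀ Y H) (n : ℕ)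
    {f : ((Fin (n + 1) → S) × (Fin n → ℝ)) × ℝ → ENNReal} (hf : Measurable f) :
    ∫⁻ ω, f (trajectory Y H n ω, H n ω) ∂P =
      ∫⁻ ω, ∫⁻ s, f (trajectory Y H n ω, s) ∂(expMeasure (exitRate r (Y n ω))) ∂P := by
  refine h.lintegral_congr_path n fun y hy => ?_
  have hsum : ∫⁻ ω in pathEvent Y n y, f (trajectory Y H n ω, H n ω) ∂P =
      ∫⁻ ω in pathEvent Y n y,
        ∫⁻ s, f (trajectory Y H n ω, s) ∂(expMeasure (exitRate r (y n))) ∂P := by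
    rw [lintegral_eq_tsum_fiber _ (h.measurable_state (n + 1))]
    simp only [Measure.restrict_restrict (h.measurable_state _ (measurableSet_singleton _)),
      inter_comm _ (pathEvent Y n y), h.lintegral_pathEvent_inter n _ hy hf]
    rw [ENNReal.tsum_mul_right, tsum_ofReal_rate_div (h.exitRate_pos _) (h.rate_nonneg _), one_mul]
  exact hsum.trans <| setLIntegral_congr_fun (h.measurableSet_pathEvent n y) fun ω hω => by
    simp only [hω n le_rfl]

lemma lintegral_window (h : IsJumpHold P r x₀ Y H) (n : ℕ) (t : ℝ)
    {f : (Fin (n + 1) → S) × (Fin n → ℝ) → ENNReal} (hf : Measurable f) :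
    ∫⁻ ω in window H n t, f (trajectory Y H n ω) ∂P =
      ∫⁻ ω, survival (exitRate r (Y n ω)) (t - jumpTime H n ω) * f (trajectory Y H n ω) ∂P := by
  let W : Set (((Fin (n + 1) → S) × (Fin n → ℝ)) × ℝ) :=
    {w | ∑ k, w.1.2 k ≤ t ∧ t < ∑ k, w.1.2 k + w.2}
  have hW : MeasurableSet W := by
    simp only [W, ofPred_and]
    exact .inter (measurableSet_le (by fun_prop) (by fun_prop))
      (measurableSet_lt (by fun_prop) (by fun_prop))
  have hhold := h.lintegral_hold n (f := W.indicator fun w => f w.1)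
    ((hf.comp measurable_fst).indicator hW)
  rw [← lintegral_indicator (h.measurableSet_window n t)]
  refine Eq.trans (lintegral_congr fun ω => ?_) (hhold.trans (lintegral_congr fun ω => ?_))
  · simp only [indicator, window, W, mem_ofPred_eq, jumpTime_succ, sum_trajectory_snd]
  · rw [← expMeasure_window (h.exitRate_pos _), mul_comm, ← lintegral_indicator_const]
    · simp only [W, indicator, mem_ofPred_eq, sum_trajectory_snd]
    · rw [ofPred_and]
      exact .inter (measurableSet_le (by fun_prop) (by fun_prop))
        (measurableSet_lt (by fun_prop) (by fun_prop))

lemma lintegral_state_window (h : IsJumpHold P r x₀ Y H) (n : ℕ) (z : S) (t : ℝ)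
    {f : (Fin (n + 1) → S) × (Fin n → ℝ) → ENNReal} (hf : Measurable f) :
    ∫⁻ ω in Y n ⁻¹' {z} ∩ window H n t, f (trajectory Y H n ω) ∂P =
      ∫⁻ ω in Y n ⁻¹' {z},
        survival (exitRate r z) (t - jumpTime H n ω) * f (trajectory Y H n ω) ∂P := by
  have hz : MeasurableSet (Y n ⁻¹' {z}) := h.measurable_state n (measurableSet_singleton z)
  have hlast : MeasurableSet {w : (Fin (n + 1) → S) × (Fin n → ℝ) | w.1 (Fin.last n) = z} :=
    measurableSet_eq_fun (by fun_prop) measurable_const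
  have hwindow := h.lintegral_window n t (hf.indicator hlast)
  rw [← Measure.restrict_restrict hz, ← lintegral_indicator hz, ← lintegral_indicator hz]
  refine Eq.trans (lintegral_congr fun ω => ?_) (hwindow.trans (lintegral_congr fun ω => ?_))
  · rfl
  · by_cases hω : Y n ω = z
    · simp [indicator, trajectory, hω]
    · simp [indicator, trajectory, hω]

-- The last completed holding time and the age `v` of the current visit exchange their roles.
lemma lintegral_last_jump (h : IsJumpHold P r x₀ Y H) (n : ℕ) (z : S) (t : ℝ)
    {f : ((Fin (n + 1) → S) × (Fin n → ℝ)) × ℝ × ℝ → ENNReal} (hf : Measurable f) :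
    ∫⁻ ω in Y (n + 1) ⁻¹' {z} ∩ window H (n + 1) t,
        f (trajectory Y H n ω, H n ω, t - jumpTime H (n + 1) ω) ∂P =
      ∫⁻ v, ∫⁻ ω in window H n (t - v), ENNReal.ofReal (r (Y n ω) z / exitRate r z) *
        f (trajectory Y H n ω, t - v - jumpTime H n ω, v) ∂P ∂(expMeasure (exitRate r z)) := by
  have := isProbabilityMeasure_expMeasure (h.exitRate_pos z)
  have hYn := h.measurable_state n
  have htraj := h.measurable_trajectory n
  have hjump := h.measurable_jumpTime n
  have hrate : Measurable fun x => r x z := .of_discrete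
  have hexit : Measurable (exitRate r) := .of_discrete
  calc ∫⁻ ω in Y (n + 1) ⁻¹' {z} ∩ window H (n + 1) t,
        f (trajectory Y H n ω, H n ω, t - jumpTime H (n + 1) ω) ∂P
    _ = ∫⁻ ω in Y (n + 1) ⁻¹' {z}, survival (exitRate r z) (t - (jumpTime H n ω + H n ω)) *
          f (trajectory Y H n ω, H n ω, t - (jumpTime H n ω + H n ω)) ∂P := by
        have hwindow := h.lintegral_state_window (n + 1) z t
          (f := fun w => f ((fun k => w.1 k.castSucc, fun k => w.2 k.castSucc),
            w.2 (Fin.last n), t - ∑ k, w.2 k)) (by fun_prop)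
        simp only [sum_trajectory_snd] at hwindow
        simp only [← jumpTime_succ]
        exact hwindow
    _ = ∫⁻ ω, ∫⁻ v, survival (exitRate r (Y n ω)) (t - v - jumpTime H n ω) *
          (ENNReal.ofReal (r (Y n ω) z / exitRate r z) *
            f (trajectory Y H n ω, t - v - jumpTime H n ω, v)) ∂(expMeasure (exitRate r z)) ∂P := by
        have hstep := h.lintegral_step n z (f := fun w =>
          survival (exitRate r z) (t - (∑ k, w.1.2 k + w.2)) *
            f (w.1, w.2, t - (∑ k, w.1.2 k + w.2))) (by fun_prop)
        simp only [sum_trajectory_snd] at hstep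
        refine hstep.trans (lintegral_congr fun ω => ?_)
        simp only [← sub_sub, sub_right_comm t _ (jumpTime H n ω)]
        exact lintegral_expMeasure_swap (h.exitRate_pos _) (h.exitRate_pos z)
          (h.rate_nonneg _ z) _ (f := fun w => f (trajectory Y H n ω, w)) (by fun_prop)
    _ = _ := by
        rw [lintegral_lintegral_swap (by fun_prop)]
        refine lintegral_congr fun v => ?_
        have hwindow := h.lintegral_window n (t - v) (f := fun w =>
          ENNReal.ofReal (r (w.1 (Fin.last n)) z / exitRate r z) *
            f (w, t - v - ∑ k, w.2 k, v)) (by fun_prop)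
        simp only [sum_trajectory_snd] at hwindow
        exact hwindow.symm

lemma tsum_lintegral_last_jump (h : IsJumpHold P r x₀ Y H) {A : Set S} {z : S} {c : ℝ}
    (hA : MeasurableSet A) (hr : ∀ x, r x z = A.indicator (fun _ => c) x) (t : ℝ)
    {f : ∀ n, ((Fin (n + 1) → S) × (Fin n → ℝ)) × ℝ × ℝ → ENNReal} (hf : ∀ n, Measurable (f n)) :
    ∑' n, ∫⁻ ω in Y (n + 1) ⁻¹' {z} ∩ window H (n + 1) t,
        f n (trajectory Y H n ω, H n ω, t - jumpTime H (n + 1) ω) ∂P =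
      ENNReal.ofReal (c / exitRate r z) * ∫⁻ v, ∑' n, ∫⁻ ω in Y n ⁻¹' A ∩ window H n (t - v),
        f n (trajectory Y H n ω, t - v - jumpTime H n ω, v) ∂P ∂(expMeasure (exitRate r z)) := by
  have hmeas : ∀ n, Measurable fun v => ∫⁻ ω in Y n ⁻¹' A ∩ window H n (t - v),
      f n (trajectory Y H n ω, t - v - jumpTime H n ω, v) ∂P := fun n => by
    have htraj := h.measurable_trajectory n
    have hjump := h.measurable_jumpTime n
    have hwindow := h.measurable_setLIntegral_window hA n
      (f := fun w => f n (trajectory Y H n w.2, w.1 - jumpTime H n w.2, t - w.1)) (by fun_prop)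
    simpa only [Function.comp_def, id, sub_sub_cancel] using
      hwindow.comp (measurable_id.const_sub t)
  have hjump : ∀ n, ∫⁻ ω in Y (n + 1) ⁻¹' {z} ∩ window H (n + 1) t,
      f n (trajectory Y H n ω, H n ω, t - jumpTime H (n + 1) ω) ∂P =
      ENNReal.ofReal (c / exitRate r z) * ∫⁻ v, ∫⁻ ω in Y n ⁻¹' A ∩ window H n (t - v),
        f n (trajectory Y H n ω, t - v - jumpTime H n ω, v) ∂P ∂(expMeasure (exitRate r z)) :=
      fun n => by
    rw [h.lintegral_last_jump n z t (hf n), ← lintegral_const_mul _ (hmeas n)]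
    refine lintegral_congr fun v => ?_
    rw [← lintegral_const_mul' _ _ ENNReal.ofReal_ne_top,
      ← setLIntegral_indicator (h.measurable_state n hA)]
    refine lintegral_congr fun ω => ?_
    by_cases hω : Y n ω ∈ A <;> simp [hr, hω]
  rw [lintegral_tsum fun n => (hmeas n).aemeasurable, ← ENNReal.tsum_mul_left]
  exact tsum_congr hjump

lemma ae_rate_ne_zero (h : IsJumpHold P r x₀ Y H) : ∀ᵐ ω ∂P, ∀ n, r (Y n ω) (Y (n + 1) ω) ≠ 0 := by
  refine ae_all_iff.2 fun n => ?_
  have hstep : ∀ z, ∀ᵐ ω ∂P, Y (n + 1) ω = z → r (Y n ω) z ≠ 0 := fun z => by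
    let N : Set S := {x | r x z = 0}
    have hN : Measurable (N.indicator (1 : S → ENNReal)) := measurable_one.indicator .of_discrete
    have hnull : ∫⁻ ω in Y (n + 1) ⁻¹' {z}, N.indicator 1 (Y n ω) ∂P = 0 := by
      refine (h.lintegral_step n z (f := fun w => N.indicator 1 (w.1.1 (Fin.last n)))
        (by fun_prop)).trans (lintegral_eq_zero_of_ae_eq_zero (.of_forall fun ω => ?_))
      by_cases hω : r (Y n ω) z = 0 <;> simp [N, trajectory, hω]
    have hae := (lintegral_eq_zero_iff (hN.comp (h.measurable_state n))).1 hnull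
    rw [EventuallyEq,
      ae_restrict_iff' (h.measurable_state (n + 1) (measurableSet_singleton z))] at hae
    filter_upwards [hae] with ω hω hz hzero
    simpa [N, hzero] using hω hz
  filter_upwards [ae_all_iff.2 hstep] with ω hω using hω _ rfl

lemma lintegral_exp_neg_jumpTime_le (h : IsJumpHold P r x₀ Y H) {M : ℝ}
    (hM : ∀ x, exitRate r x ≤ M) (n : ℕ) :
    ∫⁻ ω, ENNReal.ofReal (Real.exp (-jumpTime H n ω)) ∂P ≤ ENNReal.ofReal (M / (M + 1)) ^ n := by
  have hhold : ∀ x, ∫⁻ s, ENNReal.ofReal (Real.exp (-s)) ∂(expMeasure (exitRate r x)) ≤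
      ENNReal.ofReal (M / (M + 1)) := fun x => by
    have hx := h.exitRate_pos x
    have hxM := hM x
    rw [lintegral_exp_neg_expMeasure hx]
    refine ENNReal.ofReal_le_ofReal ?_
    rw [div_le_div_iff₀ (by linarith) (by linarith)]
    linarith
  induction n with
  | zero => simp [jumpTime]
  | succ n ih =>
    have hjump := h.measurable_jumpTime n
    have hstep := h.lintegral_hold n (f := fun w => ENNReal.ofReal (Real.exp (-∑ k, w.1.2 k)) *
      ENNReal.ofReal (Real.exp (-w.2))) (by fun_prop)
    simp only [sum_trajectory_snd] at hstep
    simp only [jumpTime_succ, neg_add, Real.exp_add, ENNReal.ofReal_mul (Real.exp_pos _).le]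
    calc ∫⁻ ω, ENNReal.ofReal (Real.exp (-jumpTime H n ω)) * ENNReal.ofReal (Real.exp (-H n ω)) ∂P
      _ ≤ ∫⁻ ω, ENNReal.ofReal (Real.exp (-jumpTime H n ω)) * ENNReal.ofReal (M / (M + 1)) ∂P := by
          refine hstep.trans_le (lintegral_mono fun ω => ?_)
          rw [lintegral_const_mul _ (by fun_prop)]
          gcongr
          exact hhold _
      _ ≤ ENNReal.ofReal (M / (M + 1)) ^ (n + 1) := by
          rw [lintegral_mul_const _ (by fun_prop), pow_succ]
          gcongr

lemma ae_exists_lt_jumpTime (h : IsJumpHold P r x₀ Y H) {M : ℝ} (hM : ∀ x, exitRate r x ≤ M) :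
    ∀ᵐ ω ∂P, ∀ t : ℝ, ∃ n, t < jumpTime H n ω := by
  have hM0 : 0 < M := (h.exitRate_pos x₀).trans_le (hM x₀)
  have hbound : Tendsto (fun n : ℕ => ENNReal.ofReal (M / (M + 1)) ^ n) atTop (𝓝 0) := by
    refine ENNReal.tendsto_pow_atTop_nhds_zero_of_lt_one ?_
    rw [ENNReal.ofReal_lt_one, div_lt_one (by linarith)]
    linarith
  have hnat : ∀ m : ℕ, ∀ᵐ ω ∂P, ∃ n, (m : ℝ) < jumpTime H n ω := fun m => by
    have hexp : ENNReal.ofReal (Real.exp (-m)) ≠ 0 := by simp [Real.exp_pos]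
    have hmarkov : ∀ n, P {ω | ¬∃ n, (m : ℝ) < jumpTime H n ω} ≤
        ENNReal.ofReal (M / (M + 1)) ^ n / ENNReal.ofReal (Real.exp (-m)) := fun n => by
      have hjump := h.measurable_jumpTime n
      refine le_trans (measure_mono fun ω hω => ?_) ((meas_ge_le_lintegral_div
        (f := fun ω => ENNReal.ofReal (Real.exp (-jumpTime H n ω))) (by fun_prop) hexp
        ENNReal.ofReal_ne_top).trans
        (ENNReal.div_le_div_right (h.lintegral_exp_neg_jumpTime_le hM n) _))
      simp only [mem_ofPred_eq, not_exists, not_lt] at hω ⊢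
      gcongr
      exact hω n
    have hlim := ENNReal.Tendsto.div_const hbound (b := ENNReal.ofReal (Real.exp (-m))) (.inr hexp)
    rw [ENNReal.zero_div] at hlim
    exact ae_iff.2 (le_antisymm (ge_of_tendsto' hlim hmarkov) bot_le)
  filter_upwards [ae_all_iff.2 hnat] with ω hω t
  obtain ⟨m, hm⟩ := exists_nat_gt t
  obtain ⟨n, hn⟩ := hω m
  exact ⟨n, hm.trans hn⟩

end IsJumpHold

end JumpChain

/-! ### The process that follows the jump chain -/

lemma eq_mul_exp_of_eq_sub_mul_integral {f : ℝ → ℝ} {β c : ℝ}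
    (hint : ∀ a b, IntervalIntegrable f volume a b)
    (hf : ∀ t, 0 ≤ t → f t = c - β * ∫ u in 0..t, f u) {t : ℝ} (ht : 0 ≤ t) :
    f t = c * Real.exp (-(β * t)) := by
  let g : ℝ → ℝ := fun t => c - β * ∫ u in 0..t, f u
  have hg : Continuous g := by
    have := intervalIntegral.continuous_primitive hint 0
    fun_prop
  have hderiv : ∀ x, 0 ≤ x → HasDerivWithinAt g (-(β * g x)) (Ici x) x := fun x hx => by
    have hfx : ContinuousWithinAt f (Ici x) x :=
      hg.continuousWithinAt.congr (fun u hu => hf u (hx.trans hu)) (hf x hx)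
    have hprimitive := intervalIntegral.integral_hasDerivWithinAt_right (hint 0 x)
      ⟨Ioc x (x + 1), Ioc_mem_nhdsGT (lt_add_one x), (hint x (x + 1)).1.aestronglyMeasurable⟩
      (hfx.mono Ioi_subset_Ici_self) (s := Ici x)
    rw [hf x hx] at hprimitive
    exact (hprimitive.const_mul β).const_sub c
  have hexp : ∀ x : ℝ, HasDerivAt (fun x => Real.exp (β * x)) (Real.exp (β * x) * β) x :=
    fun x => by simpa using ((hasDerivAt_id x).const_mul β).exp
  have hconst := constant_of_has_deriv_right_zero (f := fun x => Real.exp (β * x) * g x)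
    (a := 0) (b := t) (by fun_prop) (fun x hx =>
      ((hexp x).hasDerivWithinAt.mul (hderiv x hx.1)).congr_deriv (by ring)) t ⟨ht, le_rfl⟩
  have hg0 : g 0 = c := by simp [g]
  rw [mul_zero, Real.exp_zero, one_mul, hg0] at hconst
  rw [hf t ht, Real.exp_neg, ← div_eq_mul_inv, eq_div_iff (Real.exp_ne_zero _), mul_comm]
  exact hconst

lemma eq_of_renewal {lam β : ℝ} (hlam : 0 < lam) (hβ : 0 < β) {p : ℝ → ℝ} (hp : Measurable p)
    (hp_mem : ∀ u, p u ∈ Icc (0 : ℝ) 1)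
    (hren : ∀ t, 0 ≤ t → p t = Real.exp (-(lam * t)) +
      β * ∫ u in 0..t, Real.exp (-(lam * (t - u))) * (1 - p u)) {t : ℝ} (ht : 0 ≤ t) :
    p t = β / (lam + β) + lam / (lam + β) * Real.exp (-((lam + β) * t)) := by
  let f : ℝ → ℝ := fun u => Real.exp (lam * u) * (p u - β / (lam + β))
  have hint : ∀ a b, IntervalIntegrable f volume a b := fun a b => by
    refine IntervalIntegrable.continuousOn_mul (.sub ?_ intervalIntegrable_const) (by fun_prop)
    refine (intervalIntegrable_const (c := (1 : ℝ))).mono_fun (by fun_prop)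
      (.of_forall fun u => ?_)
    simpa only [norm_one, Real.norm_of_nonneg (hp_mem u).1] using (hp_mem u).2
  have hf : ∀ x, 0 ≤ x → f x = lam / (lam + β) - β * ∫ u in 0..x, f u := fun x hx => by
    have hexp : ∫ u in 0..x, Real.exp (lam * u) = (Real.exp (lam * x) - 1) / lam := by
      rw [intervalIntegral.integral_comp_mul_left (fun u => Real.exp u) hlam.ne', integral_exp,
        mul_zero, Real.exp_zero, smul_eq_mul, inv_mul_eq_div]
    have hgap : ∫ u in 0..x, Real.exp (-(lam * (x - u))) * (1 - p u) =
        Real.exp (-(lam * x)) *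
          (lam / (lam + β) * ((Real.exp (lam * x) - 1) / lam) - ∫ u in 0..x, f u) := by
      rw [← hexp, ← intervalIntegral.integral_const_mul, ← intervalIntegral.integral_sub
        (Continuous.intervalIntegrable (by fun_prop) _ _) (hint 0 x),
        ← intervalIntegral.integral_const_mul]
      refine intervalIntegral.integral_congr fun u _ => ?_
      have hshift : Real.exp (-(lam * (x - u))) = Real.exp (-(lam * x)) * Real.exp (lam * u) := by
        rw [← Real.exp_add]
        ring_nf
      simp only [f, hshift]
      field_simp
      ring
    have hfx : f x = Real.exp (lam * x) * (p x - β / (lam + β)) := rfl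
    rw [hfx, hren x hx, hgap, Real.exp_neg]
    field_simp
    ring
  have hsol : Real.exp (lam * t) * (p t - β / (lam + β)) = lam / (lam + β) * Real.exp (-(β * t)) :=
    eq_mul_exp_of_eq_sub_mul_integral hint hf ht
  rw [add_mul, neg_add, Real.exp_add, Real.exp_neg (lam * t), ← sub_eq_iff_eq_add',
    ← mul_left_cancel_iff_of_pos (Real.exp_pos (lam * t)), hsol]
  field_simp

section JumpProcess

variable {S Ω : Type*}

/-- The path `f` takes the value `y n` from the jump time `T n` to the jump time `T (n + 1)`. -/
structure IsJumpPath (y : ℕ → S) (T : ℕ → ℝ≥0) (f : ℝ≥0 → S) : Prop where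
  zero : T 0 = 0
  strictMono : StrictMono T
  exists_lt : ∀ t, ∃ n, t < T n
  eq : ∀ n t, T n ≤ t → t < T (n + 1) → f t = y n

namespace IsJumpPath

variable {y : ℕ → S} {T : ℕ → ℝ≥0} {f : ℝ≥0 → S}

lemma exists_index (h : IsJumpPath y T f) (t : ℝ≥0) : ∃ n, T n ≤ t ∧ t < T (n + 1) := by
  classical
  have hspec := Nat.find_spec (h.exists_lt t)
  obtain ⟨n, hn⟩ := Nat.exists_eq_succ_of_ne_zero (n := Nat.find (h.exists_lt t)) fun h0 => by
    rw [h0, h.zero] at hspec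
    exact not_lt_zero hspec
  rw [hn] at hspec
  exact ⟨n, not_lt.1 (Nat.find_min (h.exists_lt t) (by omega)), hspec⟩

lemma index_le (h : IsJumpPath y T f) {m n : ℕ} {u t : ℝ≥0} (hm : T m ≤ u) (hu : u ≤ t)
    (hn : t < T (n + 1)) : m ≤ n :=
  Nat.lt_succ_iff.1 (h.strictMono.lt_iff_lt.1 ((hm.trans hu).trans_lt hn))

end IsJumpPath

lemma window_index_unique {H : ℕ → Ω → ℝ} {ω : Ω} (hω : ∀ k, 0 < H k ω) {m n : ℕ} {t : ℝ}
    (hm : ω ∈ window H m t) (hn : ω ∈ window H n t) : m = n := by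
  have hmono : StrictMono fun n => jumpTime H n ω := strictMono_nat_of_lt_succ fun n => by
    rw [jumpTime_succ]
    linarith [hω n]
  have hmn := hmono.lt_iff_lt.1 (hm.1.trans_lt hn.2)
  have hnm := hmono.lt_iff_lt.1 (hn.1.trans_lt hm.2)
  omega

variable [MeasurableSpace Ω]

/-- Probability that the process `s` is in one of the states of `A` at time `t`, set to `0` for
`t < 0`. -/
noncomputable def occupation (P : Measure Ω) (s : ℝ≥0 → Ω → S) (A : Set S) (t : ℝ) : ENNReal :=
  if 0 ≤ t then P (s t.toNNReal ⁻¹' A) else 0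

lemma occupation_coe (P : Measure Ω) (s : ℝ≥0 → Ω → S) (A : Set S) (t : ℝ≥0) :
    occupation P s A t = P (s t ⁻¹' A) := by
  rw [occupation, if_pos t.coe_nonneg, Real.toNNReal_coe]

lemma occupation_le_one (P : Measure Ω) [IsProbabilityMeasure P] (s : ℝ≥0 → Ω → S) (A : Set S)
    (t : ℝ) : occupation P s A t ≤ 1 := by
  unfold occupation
  split_ifs
  · exact prob_le_one
  · exact zero_le_one

lemma toReal_occupation_mem_Icc (P : Measure Ω) [IsProbabilityMeasure P] (s : ℝ≥0 → Ω → S)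
    (A : Set S) (t : ℝ) : (occupation P s A t).toReal ∈ Icc (0 : ℝ) 1 :=
  ⟨ENNReal.toReal_nonneg, ENNReal.toReal_mono ENNReal.one_ne_top (occupation_le_one P s A t)⟩

variable [MeasurableSpace S]

/-- The process `s` follows the jump chain `Y` with the holding times `H`: it is `IsCTMC` with the
witnesses `Y` and `H` fixed and the absence of explosion built in. -/
structure IsJumpProcess (P : Measure Ω) (r : S → S → ℝ) (x₀ : S) (s : ℝ≥0 → Ω → S)
    (Y : ℕ → Ω → S) (H : ℕ → Ω → ℝ) : Prop extends IsJumpHold P r x₀ Y H where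
  measurable_process : ∀ t, Measurable (s t)
  ae_isJumpPath : ∀ᵐ ω ∂P,
    IsJumpPath (fun n => Y n ω) (fun n => (jumpTime H n ω).toNNReal) (fun t => s t ω)

lemma IsCTMC.exists_isJumpProcess [Countable S] [MeasurableSingletonClass S] {P : Measure Ω}
    [IsProbabilityMeasure P] {r : S → S → ℝ} {x₀ : S} {s : ℝ≥0 → Ω → S} {M : ℝ}
    (h : IsCTMC P r x₀ s) (hr : ∀ x y, 0 ≤ r x y) (he : ∀ x, 0 < exitRate r x)
    (hM : ∀ x, exitRate r x ≤ M) : ∃ Y H, IsJumpProcess P r x₀ s Y H := by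
  obtain ⟨hs, Y, H, hY, hH, hlaw, hpath⟩ := h
  have hhold : IsJumpHold P r x₀ Y H :=
    ⟨hr, he, fun n => measurable_to_countable' (hY n), hH, hlaw⟩
  refine ⟨Y, H, hhold, fun t => measurable_to_countable' (hs t), ?_⟩
  filter_upwards [hhold.ae_hold_pos, hhold.ae_exists_lt_jumpTime hM, hpath] with ω hpos hlt hω
  have hnonneg : ∀ n, 0 ≤ jumpTime H n ω := fun n => Finset.sum_nonneg fun k _ => (hpos k).le
  refine ⟨by simp [jumpTime], strictMono_nat_of_lt_succ fun n => ?_, fun t => ?_,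
    fun n t hn ht => hω n t (Real.toNNReal_le_iff_le_coe.1 hn) (Real.lt_toNNReal_iff_coe_lt.1 ht)⟩
  · rw [Real.toNNReal_lt_toNNReal_iff_of_nonneg (hnonneg n), jumpTime_succ]
    linarith [hpos n]
  · obtain ⟨n, hn⟩ := hlt t
    exact ⟨n, Real.lt_toNNReal_iff_coe_lt.2 hn⟩

namespace IsJumpProcess

variable {P : Measure Ω} {r : S → S → ℝ} {x₀ : S} {s : ℝ≥0 → Ω → S} {Y : ℕ → Ω → S}
  {H : ℕ → Ω → ℝ}

lemma ae_exists_window (h : IsJumpProcess P r x₀ s Y H) (t : ℝ≥0) :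
    ∀ᵐ ω ∂P, ∃ n, ω ∈ window H n t ∧ s t ω = Y n ω := by
  filter_upwards [h.ae_isJumpPath] with ω hω
  obtain ⟨n, hn, hn'⟩ := hω.exists_index t
  exact ⟨n, ⟨Real.toNNReal_le_iff_le_coe.1 hn, Real.lt_toNNReal_iff_coe_lt.1 hn'⟩,
    hω.eq n t hn hn'⟩

variable [IsProbabilityMeasure P]

lemma occupation_compl (h : IsJumpProcess P r x₀ s Y H) {A : Set S} (hA : MeasurableSet A) {t : ℝ}
    (ht : 0 ≤ t) : occupation P s Aᶜ t = 1 - occupation P s A t := by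
  rw [occupation, occupation, if_pos ht, if_pos ht, preimage_compl,
    prob_compl_eq_one_sub (h.measurable_process _ hA)]

variable [Countable S] [MeasurableSingletonClass S]

lemma setLIntegral_eq_tsum_window (h : IsJumpProcess P r x₀ s Y H) {A : Set S}
    (hA : MeasurableSet A) (t : ℝ≥0) (f : Ω → ENNReal) :
    ∫⁻ ω in s t ⁻¹' A, f ω ∂P = ∑' n, ∫⁻ ω in Y n ⁻¹' A ∩ window H n t, f ω ∂P := by
  rw [← lintegral_iUnion₀]
  · refine setLIntegral_congr ?_
    filter_upwards [h.ae_exists_window t, h.ae_hold_pos] with ω ⟨n, hn, hsn⟩ hpos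
    refine propext (Iff.trans ?_ mem_iUnion.symm)
    refine ⟨fun hω => ⟨n, hsn.subst (motive := (· ∈ A)) hω, hn⟩, ?_⟩
    rintro ⟨m, hm, hmw⟩
    obtain rfl := window_index_unique hpos hn hmw
    exact hsn.symm.subst (motive := (· ∈ A)) hm
  · exact fun n => ((h.measurable_state n hA).inter (h.measurableSet_window n t)).nullMeasurableSet
  · refine fun m n hmn => measure_mono_null ?_ (ae_iff.1 h.ae_hold_pos)
    exact fun ω hω hpos => hmn (window_index_unique hpos hω.1.2 hω.2.2)

lemma occupation_eq_tsum (h : IsJumpProcess P r x₀ s Y H) {A : Set S} (hA : MeasurableSet A)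
    (t : ℝ) : occupation P s A t = ∑' n, P (Y n ⁻¹' A ∩ window H n t) := by
  unfold occupation
  split_ifs with ht
  · have hwindow := h.setLIntegral_eq_tsum_window hA t.toNNReal 1
    simpa only [Pi.one_apply, setLIntegral_one, Real.coe_toNNReal t ht] using hwindow
  · refine (ENNReal.tsum_eq_zero.2 fun n => ?_).symm
    refine measure_mono_null ?_ (ae_iff.1 h.ae_hold_pos)
    exact fun ω hω hpos => ht ((Finset.sum_nonneg fun k _ => (hpos k).le).trans hω.2.1)

lemma measurable_occupation (h : IsJumpProcess P r x₀ s Y H) {A : Set S} (hA : MeasurableSet A) :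
    Measurable (occupation P s A) := by
  rw [funext (h.occupation_eq_tsum hA)]
  exact .tsum fun n => h.measurable_measure_window hA n

lemma measure_start_window_zero (h : IsJumpProcess P r x₀ s Y H) (t : ℝ) :
    P (Y 0 ⁻¹' {x₀} ∩ window H 0 t) = survival (exitRate r x₀) t := by
  have hwindow := h.lintegral_state_window 0 x₀ t measurable_one
  have hstart : P (Y 0 ⁻¹' {x₀}) = 1 :=
    (mem_ae_iff_prob_eq_one (h.measurable_state 0 (measurableSet_singleton x₀))).1 h.ae_start
  simpa [jumpTime, hstart] using hwindow

lemma occupation_start_eq (h : IsJumpProcess P r x₀ s Y H) {c : ℝ} (h0 : r x₀ x₀ = 0)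
    (hc : ∀ x ≠ x₀, r x x₀ = c) (t : ℝ) :
    occupation P s {x₀} t = survival (exitRate r x₀) t + ENNReal.ofReal (c / exitRate r x₀) *
      ∫⁻ v, occupation P s {x₀}ᶜ (t - v) ∂(expMeasure (exitRate r x₀)) := by
  have hx₀ : MeasurableSet ({x₀} : Set S) := measurableSet_singleton x₀
  have hrate : ∀ x, r x x₀ = ({x₀}ᶜ : Set S).indicator (fun _ => c) x := fun x => by
    by_cases hx : x = x₀
    · simp [hx, h0]
    · simp [hx, hc x hx]
  have hjump := h.tsum_lintegral_last_jump hx₀.compl hrate t fun _ => measurable_one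
  simp only [Pi.one_apply, setLIntegral_one, ← h.occupation_eq_tsum hx₀.compl] at hjump
  rw [h.occupation_eq_tsum hx₀, tsum_eq_zero_add' ENNReal.summable, h.measure_start_window_zero,
    hjump]

lemma lintegral_occupation_compl (h : IsJumpProcess P r x₀ s Y H) {A : Set S}
    (hA : MeasurableSet A) {e : ℝ} (he : 0 < e) {t : ℝ} (ht : 0 ≤ t) :
    ∫⁻ v, occupation P s Aᶜ (t - v) ∂(expMeasure e) = ENNReal.ofReal (e *
      ∫ u in 0..t, Real.exp (-(e * (t - u))) * (1 - (occupation P s A u).toReal)) := by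
  let p : ℝ → ℝ := fun u => (occupation P s A u).toReal
  have hp : Measurable p := (h.measurable_occupation hA).ennreal_toReal
  have hnonneg : ∀ u, 0 ≤ Real.exp (-(e * (t - u))) * (1 - p u) := fun u =>
    mul_nonneg (Real.exp_pos _).le (sub_nonneg.2 (toReal_occupation_mem_Icc P s A u).2)
  have hint : IntegrableOn (fun u => Real.exp (-(e * (t - u))) * (1 - p u)) (Icc 0 t) := by
    refine Measure.integrableOn_of_bounded (M := 1) measure_Icc_lt_top.ne (by fun_prop) ?_
    filter_upwards [ae_restrict_mem measurableSet_Icc] with u hu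
    rw [Real.norm_of_nonneg (hnonneg u)]
    refine mul_le_one₀ (Real.exp_le_one_iff.2 ?_)
      (sub_nonneg.2 (toReal_occupation_mem_Icc P s A u).2)
      (sub_le_self 1 (toReal_occupation_mem_Icc P s A u).1)
    exact neg_nonpos.2 (mul_nonneg he.le (sub_nonneg.2 hu.2))
  have hdensity : ∀ u, survival e (t - u) * occupation P s Aᶜ u = (Icc 0 t).indicator
      (fun u => ENNReal.ofReal (Real.exp (-(e * (t - u))) * (1 - p u))) u := fun u => by
    by_cases hu : 0 ≤ u
    · have hcompl : occupation P s Aᶜ u = ENNReal.ofReal (1 - p u) := by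
        rw [h.occupation_compl hA hu, ENNReal.ofReal_sub _ ENNReal.toReal_nonneg,
          ENNReal.ofReal_one, ENNReal.ofReal_toReal
            ((occupation_le_one P s A u).trans_lt ENNReal.one_lt_top).ne]
      by_cases hut : u ≤ t <;>
        simp [survival, hu, hut, hcompl, ENNReal.ofReal_mul (Real.exp_pos _).le]
    · simp [occupation, hu]
  rw [lintegral_expMeasure he (f := fun v => occupation P s Aᶜ (t - v))
      ((h.measurable_occupation hA.compl).comp (measurable_id.const_sub t)),
    ← lintegral_sub_left_eq_self _ t, ENNReal.ofReal_mul he.le,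
    intervalIntegral.integral_of_le ht, ← integral_Icc_eq_integral_Ioc,
    ofReal_integral_eq_lintegral_ofReal hint (.of_forall hnonneg),
    ← lintegral_indicator measurableSet_Icc]
  simp only [sub_sub_cancel, hdensity]

lemma toReal_occupation_start (h : IsJumpProcess P r x₀ s Y H) {c : ℝ} (h0 : r x₀ x₀ = 0)
    (hc : ∀ x ≠ x₀, r x x₀ = c) (hcpos : 0 < c) {t : ℝ} (ht : 0 ≤ t) :
    (occupation P s {x₀} t).toReal = c / (exitRate r x₀ + c) +
      exitRate r x₀ / (exitRate r x₀ + c) * Real.exp (-((exitRate r x₀ + c) * t)) := by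
  have he := h.exitRate_pos x₀
  have hx₀ : MeasurableSet ({x₀} : Set S) := measurableSet_singleton x₀
  refine eq_of_renewal he hcpos (p := fun t => (occupation P s {x₀} t).toReal)
    (h.measurable_occupation hx₀).ennreal_toReal (toReal_occupation_mem_Icc P s {x₀})
    (fun t ht => ?_) ht
  have hnonneg : 0 ≤ ∫ u in 0..t,
      Real.exp (-(exitRate r x₀ * (t - u))) * (1 - (occupation P s {x₀} u).toReal) :=
    intervalIntegral.integral_nonneg ht fun u _ => mul_nonneg (Real.exp_pos _).le
      (sub_nonneg.2 (toReal_occupation_mem_Icc P s {x₀} u).2)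
  rw [h.occupation_start_eq h0 hc, h.lintegral_occupation_compl hx₀ he ht,
    ← ENNReal.ofReal_mul (div_pos hcpos he).le, survival, if_pos ht,
    ← ENNReal.ofReal_add (Real.exp_pos _).le (by positivity), ENNReal.toReal_ofReal (by positivity),
    ← mul_assoc, div_mul_cancel₀ _ he.ne']

lemma tendsto_occupation_start (h : IsJumpProcess P r x₀ s Y H) {c : ℝ} (h0 : r x₀ x₀ = 0)
    (hc : ∀ x ≠ x₀, r x x₀ = c) (hcpos : 0 < c) :
    Tendsto (fun t => (occupation P s {x₀} t).toReal) atTop (𝓝 (c / (exitRate r x₀ + c))) := by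
  have hrate : 0 < exitRate r x₀ + c := add_pos (h.exitRate_pos x₀) hcpos
  have hexp : Tendsto (fun t => Real.exp (-((exitRate r x₀ + c) * t))) atTop (𝓝 0) :=
    Real.tendsto_exp_neg_atTop_nhds_zero.comp (tendsto_id.const_mul_atTop hrate)
  have hlim := (hexp.const_mul (exitRate r x₀ / (exitRate r x₀ + c))).const_add
    (c / (exitRate r x₀ + c))
  rw [mul_zero, add_zero] at hlim
  refine hlim.congr' ?_
  filter_upwards [eventually_ge_atTop 0] with t ht
  exact (h.toReal_occupation_start h0 hc hcpos ht).symm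

end IsJumpProcess

end JumpProcess

/-! ### Levels of the 1G1B system -/

section Rates

variable {lam mu q p : ℝ}

lemma exitRate_none : exitRate (rate lam mu q p) none = lam := by
  rw [exitRate, tsum_eq_single (some 0)]
  · simp [rate]
  · rintro (_ | j) hj
    · rfl
    · exact if_neg fun h0 => hj (congrArg some h0)

lemma exitRate_some (i : ℕ) : exitRate (rate lam mu q p) (some i) = mu + lam * q := by
  rw [exitRate, tsum_eq_sum (s := {none, some (i + 1)}), Finset.sum_pair (by simp)]
  · simp only [rate, if_true]
    ring
  · rintro (_ | j) hj
    · simp at hj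
    · exact if_neg fun hij => hj (by simp [hij])

lemma rate_nonneg (hlam : 0 ≤ lam) (hqp : 0 ≤ lam * q * p) (hloss : 0 ≤ mu + lam * q * (1 - p)) :
    ∀ x y, 0 ≤ rate lam mu q p x y
  | none, none => le_rfl
  | none, some _ => ite_nonneg hlam le_rfl
  | some _, none => hloss
  | some _, some _ => ite_nonneg hqp le_rfl

lemma rate_some_zero (x : Option ℕ) :
    rate lam mu q p x (some 0) = ({none} : Set (Option ℕ)).indicator (fun _ => lam) x := by
  cases x <;> simp [rate]

lemma rate_some_succ (x : Option ℕ) (i : ℕ) : rate lam mu q p x (some (i + 1)) =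
    ({some i} : Set (Option ℕ)).indicator (fun _ => lam * q * p) x := by
  cases x <;> simp [rate, indicator, eq_comm]

lemma rate_some_ne_zero {x : Option ℕ} {i : ℕ} (h : rate lam mu q p x (some i) ≠ 0) :
    (x = none ∧ i = 0) ∨ ∃ j, x = some j ∧ i = j + 1 := by
  cases x with
  | none => exact .inl ⟨rfl, of_not_not fun hi => h (if_neg hi)⟩
  | some j => exact .inr ⟨j, rfl, of_not_not fun hi => h (if_neg hi)⟩

end Rates

/-- The path `y` is in the state `none` at time `m` and then climbs from there to level `i`. -/
def IsClimb (y : ℕ → Option ℕ) (m i : ℕ) : Prop :=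
  y m = none ∧ ∀ j ≤ i, y (m + 1 + j) = some j

lemma IsClimb.eq_some_iff {y : ℕ → Option ℕ} {m i l j : ℕ} (h : IsClimb y m i) (hm : m ≤ l)
    (hi : l ≤ m + 1 + i) : y l = some j ↔ l = m + 1 + j := by
  rcases hm.eq_or_lt with rfl | hl
  · simp only [h.1, reduceCtorEq, false_iff]
    omega
  · obtain ⟨d, rfl⟩ := Nat.exists_eq_add_of_le (Nat.succ_le_of_lt hl)
    rw [h.2 d (by omega), Option.some_inj]
    omega

lemma exists_isClimb {lam mu q p : ℝ} {y : ℕ → Option ℕ} (h0 : y 0 = none)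
    (hy : ∀ n, rate lam mu q p (y n) (y (n + 1)) ≠ 0) {i n : ℕ} (hn : y n = some i) :
    ∃ m, n = m + 1 + i ∧ IsClimb y m i := by
  obtain ⟨k, rfl⟩ := Nat.exists_eq_succ_of_ne_zero (n := n) (by rintro rfl; simp [h0] at hn)
  have hstep := hy k
  rw [← Nat.succ_eq_add_one, hn] at hstep
  induction i generalizing k with
  | zero =>
    obtain ⟨hk, -⟩ := (rate_some_ne_zero hstep).resolve_right (by omega)
    refine ⟨k, rfl, hk, fun j hj => ?_⟩
    rwa [Nat.le_zero.1 hj]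
  | succ i ih =>
    obtain ⟨j, hk, hij⟩ := (rate_some_ne_zero hstep).resolve_left (by omega)
    obtain rfl : i = j := by omega
    obtain ⟨k, rfl⟩ := Nat.exists_eq_succ_of_ne_zero (n := k) (by rintro rfl; simp [h0] at hk)
    have hprev := hy k
    rw [← Nat.succ_eq_add_one, hk] at hprev
    obtain ⟨m, hm, hnone, hclimb⟩ := ih k hk hprev
    refine ⟨m, by omega, hnone, fun j hj => ?_⟩
    rcases hj.lt_or_eq with hlt | rfl
    · exact hclimb j (Nat.le_of_lt_succ hlt)
    · rwa [← add_assoc, ← hm]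

namespace IsJumpPath

variable {y : ℕ → Option ℕ} {T : ℕ → ℝ≥0} {f : ℝ≥0 → Option ℕ}

lemma visitEnd_eq (h : IsJumpPath y T f) {t : ℝ≥0} {N k j : ℕ} (hN : T N ≤ t)
    (ht : t < T (N + 1)) (hk : k ≤ N) (hy : y k = some j)
    (hlast : ∀ l, k < l → l ≤ N → y l ≠ some j) : visitEnd f t j = min (T (k + 1)) t := by
  have hTk : T k ≤ t := (h.strictMono.monotone hk).trans hN
  have hlt : T k < T (k + 1) := h.strictMono k.lt_succ_self
  have hval : ∀ u, T k ≤ u → u < T (k + 1) → f u = some j :=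
    fun u hu hu' => (h.eq k u hu hu').trans hy
  refine IsLUB.csSup_eq ⟨?_, fun w hw => le_of_forall_lt fun c hc => ?_⟩
    ⟨T k, hTk, hval _ le_rfl hlt⟩
  · rintro u ⟨hu, hfu⟩
    obtain ⟨n, hn, hn'⟩ := h.exists_index u
    have hnk : n ≤ k := not_lt.1 fun hkn =>
      hlast n hkn (h.index_le hn hu ht) ((h.eq n u hn hn').symm.trans hfu)
    exact le_min (hn'.le.trans (h.strictMono.monotone (Nat.succ_le_succ hnk))) hu
  · rcases lt_or_ge t (T (k + 1)) with htk | htk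
    · rw [min_eq_right htk.le] at hc
      exact hc.trans_le (hw ⟨le_rfl, hval t hTk htk⟩)
    · rw [min_eq_left htk] at hc
      obtain ⟨u, hu, huT⟩ := exists_between (max_lt hc hlt)
      rw [max_lt_iff] at hu
      exact hu.1.trans_le (hw ⟨huT.le.trans htk, hval u hu.2.le huT⟩)

lemma visitStart_eq (h : IsJumpPath y T f) {t : ℝ≥0} {N k j : ℕ} (hN : T N ≤ t)
    (ht : t < T (N + 1)) (hk : k + 1 ≤ N) (hprev : y k ≠ some j) (hy : y (k + 1) = some j)
    (hlast : ∀ l, k + 1 < l → l ≤ N → y l ≠ some j) : visitStart f t j = T (k + 1) := by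
  have hle : T (k + 1) ≤ min (T (k + 1 + 1)) t :=
    le_min (h.strictMono.monotone (Nat.le_succ _)) ((h.strictMono.monotone hk).trans hN)
  rw [visitStart, h.visitEnd_eq hN ht hk hy hlast]
  refine IsLeast.csInf_eq ⟨⟨hle, fun v hv hv' => ?_⟩, ?_⟩
  · exact (h.eq (k + 1) v hv (hv'.trans_le (min_le_left _ _))).trans hy
  · rintro u ⟨-, hu⟩
    refine not_lt.1 fun hlt => hprev ?_
    have hmax : max u (T k) < T (k + 1) := max_lt hlt (h.strictMono k.lt_succ_self)
    rw [← h.eq k _ (le_max_right _ _) hmax]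
    exact hu _ (le_max_left _ _) (hmax.trans_le hle)

lemma levelTimes_eq (h : IsJumpPath y T f) {t : ℝ≥0} {m i : ℕ} (hc : IsClimb y m i)
    (hT : T (m + 1 + i) ≤ t) (ht : t < T (m + 1 + i + 1)) :
    levelTimes f t i = Fin.snoc (α := fun _ => ℝ)
      (fun j : Fin i => (T (m + 1 + j + 1) : ℝ) - T (m + 1 + j)) ((t : ℝ) - T (m + 1 + i)) := by
  have hvisit : ∀ j ≤ i, visitStart f t j = T (m + 1 + j) ∧
      visitEnd f t j = min (T (m + 1 + j + 1)) t := fun j hj => by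
    have hy : y (m + j + 1) = some j := (hc.eq_some_iff (by omega) (by omega)).2 (by omega)
    have hprev : y (m + j) ≠ some j := fun hj' =>
      absurd ((hc.eq_some_iff (by omega) (by omega)).1 hj') (by omega)
    have hlast : ∀ l, m + j + 1 < l → l ≤ m + 1 + i → y l ≠ some j := fun l hl hl' hj' =>
      absurd ((hc.eq_some_iff (by omega) hl').1 hj') (by omega)
    rw [add_right_comm m 1 j]
    exact ⟨h.visitStart_eq hT ht (by omega) hprev hy hlast, h.visitEnd_eq hT ht (by omega) hy hlast⟩
  funext j
  rw [levelTimes, (hvisit j (Nat.lt_succ_iff.1 j.2)).1, (hvisit j (Nat.lt_succ_iff.1 j.2)).2]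
  induction j using Fin.lastCases with
  | last => rw [Fin.snoc_last, Fin.val_last, min_eq_right ht.le]
  | cast j =>
    rw [Fin.snoc_castSucc, Fin.val_castSucc,
      min_eq_left ((h.strictMono.monotone (by omega)).trans hT)]

end IsJumpPath

instance : MeasurableSpace (Option ℕ) := ⊤

instance : DiscreteMeasurableSpace (Option ℕ) := ⟨fun _ => trivial⟩

/-- Ratio of the steady-state probabilities of level `i` and of the state `none`. -/
noncomputable def levelWeight (lam mu q p : ℝ) (i : ℕ) : ℝ :=
  lam / (mu + lam * q) * (lam * q * p / (mu + lam * q)) ^ i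

lemma levelWeight_succ (lam mu q p : ℝ) (i : ℕ) : levelWeight lam mu q p (i + 1) =
    lam * q * p / (mu + lam * q) * levelWeight lam mu q p i := by
  simp only [levelWeight, pow_succ]
  ring

/-- Steady-state distribution of the 1G1B system. -/
noncomputable def steadyState (lam mu q p : ℝ) : Option ℕ → ℝ
  | none => (mu + lam * q * (1 - p)) / (lam + (mu + lam * q * (1 - p)))
  | some i =>
    levelWeight lam mu q p i * ((mu + lam * q * (1 - p)) / (lam + (mu + lam * q * (1 - p))))

lemma steadyState_some (lam mu q p : ℝ) (i : ℕ) : steadyState lam mu q p (some i) =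
    levelWeight lam mu q p i * steadyState lam mu q p none :=
  rfl

lemma steadyState_none_lt_one {lam mu q p : ℝ} (hlam : 0 < lam)
    (hloss : 0 < mu + lam * q * (1 - p)) : steadyState lam mu q p none < 1 := by
  rw [steadyState, div_lt_one (by positivity)]
  linarith

lemma integral_cond {Ω : Type*} [MeasurableSpace Ω] (P : Measure Ω) (E : Set Ω) (f : Ω → ℝ) :
    ∫ ω, f ω ∂(P[|E]) = (P.real E)⁻¹ * ∫ ω in E, f ω ∂P := by
  rw [ProbabilityTheory.cond, integral_smul_measure, ENNReal.toReal_inv, smul_eq_mul,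
    measureReal_def]

section Climb

variable {lam mu q p : ℝ} {Ω : Type*} [MeasurableSpace Ω] {P : Measure Ω}
  {s : ℝ≥0 → Ω → Option ℕ} {Y : ℕ → Ω → Option ℕ} {H : ℕ → Ω → ℝ}
  (h : IsJumpProcess P (rate lam mu q p) none s Y H)

namespace IsJumpProcess

include h

lemma lam_pos : 0 < lam :=
  exitRate_none.subst (h.exitRate_pos none)

lemma exit_level_pos : 0 < mu + lam * q :=
  (exitRate_some 0).subst (h.exitRate_pos (some 0))

lemma climbRate_nonneg : 0 ≤ lam * q * p :=
  h.rate_nonneg (some 0) (some 1)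

lemma levelWeight_nonneg (i : ℕ) : 0 ≤ levelWeight lam mu q p i :=
  mul_nonneg (div_pos h.lam_pos h.exit_level_pos).le
    (pow_nonneg (div_nonneg h.climbRate_nonneg h.exit_level_pos.le) i)

lemma summable_levelWeight (hloss : 0 < mu + lam * q * (1 - p)) :
    Summable (levelWeight lam mu q p) := by
  refine (summable_geometric_of_lt_one
    (div_nonneg h.climbRate_nonneg h.exit_level_pos.le) ?_).mul_left _
  rw [div_lt_one h.exit_level_pos]
  linarith

variable [IsProbabilityMeasure P]

lemma tsum_setLIntegral_succ (i : ℕ) (t : ℝ) (f : ℕ → Ω → ENNReal) :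
    ∑' n, ∫⁻ ω in Y n ⁻¹' {some i} ∩ window H n t, f n ω ∂P =
      ∑' n, ∫⁻ ω in Y (n + 1) ⁻¹' {some i} ∩ window H (n + 1) t, f (n + 1) ω ∂P := by
  rw [tsum_eq_zero_add' ENNReal.summable, setLIntegral_measure_zero, zero_add]
  refine measure_mono_null (fun ω hω => ?_) (ae_iff.1 h.ae_start)
  have hlevel : Y 0 ω = some i := hω.1
  simp [hlevel]

lemma tsum_lintegral_climb (i : ℕ) (t : ℝ) {g : (Fin (i + 1) → ℝ) → ENNReal}
    (hg : Measurable g) :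
    ∑' n, ∫⁻ ω in Y n ⁻¹' {some i} ∩ window H n t,
        g (Fin.snoc (lastEntries i (trajectory Y H n ω).2) (t - jumpTime H n ω)) ∂P =
      ENNReal.ofReal (levelWeight lam mu q p i) *
        ∫⁻ x, g x * occupation P s {none} (t - ∑ j, x j) ∂(iidExp (mu + lam * q) i) := by
  have hocc := h.measurable_occupation (measurableSet_singleton none)
  have hrate := h.exit_level_pos
  induction i generalizing t with
  | zero =>
    have hjump := h.tsum_lintegral_last_jump (measurableSet_singleton none) rate_some_zero t
      (f := fun n w => g (Fin.snoc Fin.elim0 w.2.2)) (fun n => by fun_prop)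
    rw [h.tsum_setLIntegral_succ, lintegral_iidExp_zero hrate (by fun_prop)]
    rw [exitRate_some] at hjump
    refine hjump.trans ?_
    simp only [lintegral_const, Measure.restrict_apply_univ, ENNReal.tsum_mul_left,
      ← h.occupation_eq_tsum (measurableSet_singleton none)]
    simp [levelWeight, Fin.snoc]
  | succ i ih =>
    have hjump := h.tsum_lintegral_last_jump (measurableSet_singleton (some i))
      (fun x => rate_some_succ x i) t
      (f := fun n w => g (Fin.snoc (Fin.snoc (lastEntries i w.1.2) w.2.1) w.2.2))
      (fun n => by fun_prop)
    rw [h.tsum_setLIntegral_succ, lintegral_iidExp_succ hrate i (by fun_prop)]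
    rw [exitRate_some] at hjump
    refine hjump.trans ?_
    have hprev : ∀ v, ∑' n, ∫⁻ ω in Y n ⁻¹' {some i} ∩ window H n (t - v),
        g (Fin.snoc (Fin.snoc (lastEntries i (trajectory Y H n ω).2)
          (t - v - jumpTime H n ω)) v) ∂P =
        ENNReal.ofReal (levelWeight lam mu q p i) * ∫⁻ x, g (Fin.snoc x v) *
          occupation P s {none} (t - v - ∑ j, x j) ∂(iidExp (mu + lam * q) i) := fun v =>
      ih (t - v) (g := fun x => g (Fin.snoc x v)) (by fun_prop)
    simp only [hprev, lintegral_const_mul' _ _ ENNReal.ofReal_ne_top]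
    rw [← mul_assoc, levelWeight_succ,
      ENNReal.ofReal_mul (div_nonneg h.climbRate_nonneg h.exit_level_pos.le)]
    simp only [Fin.sum_snoc, sub_add_eq_sub_sub_swap]

lemma ae_levelTimes_eq (t : ℝ≥0) (i : ℕ) :
    ∀ᵐ ω ∂P, ∀ n, Y n ω = some i → ω ∈ window H n t → levelTimes (fun u => s u ω) t i =
      Fin.snoc (lastEntries i (trajectory Y H n ω).2) (t - jumpTime H n ω) := by
  filter_upwards [h.ae_start, h.ae_rate_ne_zero, h.ae_hold_pos, h.ae_isJumpPath]
    with ω h0 hrate hpos hpath n hn hω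
  obtain ⟨m, rfl, hclimb⟩ := exists_isClimb h0 hrate hn
  have hcoe : ∀ n, ((jumpTime H n ω).toNNReal : ℝ) = jumpTime H n ω := fun n =>
    Real.coe_toNNReal _ (Finset.sum_nonneg fun k _ => (hpos k).le)
  have hlast : lastEntries i (trajectory Y H (m + 1 + i) ω).2 = fun j : Fin i =>
      jumpTime H (m + 1 + j + 1) ω - jumpTime H (m + 1 + j) ω := by
    funext j
    rw [jumpTime_succ, add_sub_cancel_left]
    exact lastEntries_apply _ j
  rw [hpath.levelTimes_eq hclimb (Real.toNNReal_le_iff_le_coe.2 hω.1)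
    (Real.lt_toNNReal_iff_coe_lt.2 hω.2), hlast]
  simp only [hcoe]

lemma setLIntegral_congr_levelTimes (t : ℝ≥0) (i n : ℕ)
    (g : (Fin (i + 1) → ℝ) → ENNReal) :
    ∫⁻ ω in Y n ⁻¹' {some i} ∩ window H n t, g (levelTimes (fun u => s u ω) t i) ∂P =
      ∫⁻ ω in Y n ⁻¹' {some i} ∩ window H n t,
        g (Fin.snoc (lastEntries i (trajectory Y H n ω).2) (t - jumpTime H n ω)) ∂P := by
  refine setLIntegral_congr_fun_ae
    ((h.measurable_state n (measurableSet_singleton _)).inter (h.measurableSet_window n t)) ?_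
  filter_upwards [h.ae_levelTimes_eq t i] with ω hω hn
  rw [hω n hn.1 hn.2]

lemma lintegral_levelTimes (t : ℝ≥0) (i : ℕ) {g : (Fin (i + 1) → ℝ) → ENNReal}
    (hg : Measurable g) :
    ∫⁻ ω in s t ⁻¹' {some i}, g (levelTimes (fun u => s u ω) t i) ∂P =
      ENNReal.ofReal (levelWeight lam mu q p i) *
        ∫⁻ x, g x * occupation P s {none} (t - ∑ j, x j) ∂(iidExp (mu + lam * q) i) := by
  rw [h.setLIntegral_eq_tsum_window (measurableSet_singleton _), ← h.tsum_lintegral_climb i t hg]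
  exact tsum_congr fun n => h.setLIntegral_congr_levelTimes t i n g

lemma aemeasurable_levelTimes (t : ℝ≥0) (i : ℕ) :
    AEMeasurable (fun ω => levelTimes (fun u => s u ω) t i) (P.restrict (s t ⁻¹' {some i})) := by
  have hmeas : ∀ n, MeasurableSet (Y n ⁻¹' {some i} ∩ window H n t) := fun n =>
    (h.measurable_state n (measurableSet_singleton _)).inter (h.measurableSet_window n t)
  have hcover : s t ⁻¹' {some i} ≤ᵐ[P] ⋃ n, Y n ⁻¹' {some i} ∩ window H n t := by
    filter_upwards [h.ae_exists_window t] with ω ⟨n, hn, hsn⟩ hω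
    exact mem_iUnion.2 ⟨n, hsn.symm.trans hω, hn⟩
  refine AEMeasurable.mono_measure (aemeasurable_iUnion_iff.2 fun n => ?_)
    (Measure.restrict_mono_ae hcover)
  refine ⟨fun ω => Fin.snoc (lastEntries i (trajectory Y H n ω).2) (t - jumpTime H n ω),
    measurable_snoc ((measurable_lastEntries i).comp (h.measurable_trajectory n).snd)
      ((h.measurable_jumpTime n).const_sub _), ?_⟩
  filter_upwards [ae_restrict_of_ae (h.ae_levelTimes_eq t i), ae_restrict_mem (hmeas n)]
    with ω hω hn
  exact hω n hn.1 hn.2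

lemma map_levelTimes (t : ℝ≥0) (i : ℕ) :
    (P.restrict (s t ⁻¹' {some i})).map (fun ω => levelTimes (fun u => s u ω) t i) =
      (iidExp (mu + lam * q) i).withDensity fun x => ENNReal.ofReal (levelWeight lam mu q p i) *
        occupation P s {none} (t - ∑ j, x j) := by
  have hocc := h.measurable_occupation (measurableSet_singleton none)
  refine Measure.ext_of_lintegral _ fun g hg => ?_
  rw [lintegral_map' hg.aemeasurable (h.aemeasurable_levelTimes t i), h.lintegral_levelTimes t i hg,
    lintegral_withDensity_eq_lintegral_mul _ (by fun_prop) hg,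
    ← lintegral_const_mul' _ _ ENNReal.ofReal_ne_top]
  exact lintegral_congr fun x => by simp only [Pi.mul_apply]; ring

lemma map_levelTimes_absolutelyContinuous (t : ℝ≥0) (i : ℕ) :
    (P.restrict (s t ⁻¹' {some i})).map (fun ω => levelTimes (fun u => s u ω) t i) ≪
      iidExp (mu + lam * q) i :=
  h.map_levelTimes t i ▸ withDensity_absolutelyContinuous _ _

lemma setIntegral_levelTimes (t : ℝ≥0) (i : ℕ) {g : (Fin (i + 1) → ℝ) → ℝ}
    (hg : AEStronglyMeasurable g (iidExp (mu + lam * q) i)) :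
    ∫ ω in s t ⁻¹' {some i}, g (levelTimes (fun u => s u ω) t i) ∂P =
      levelWeight lam mu q p i *
        ∫ x, (occupation P s {none} (t - ∑ j, x j)).toReal * g x ∂(iidExp (mu + lam * q) i) := by
  have hocc := h.measurable_occupation (measurableSet_singleton none)
  rw [← integral_map (h.aemeasurable_levelTimes t i)
      (hg.mono_ac (h.map_levelTimes_absolutelyContinuous t i)), h.map_levelTimes,
    integral_withDensity_eq_integral_toReal_smul (by fun_prop) (.of_forall fun x =>
      ENNReal.mul_lt_top ENNReal.ofReal_lt_top
        ((occupation_le_one P s {none} _).trans_lt ENNReal.one_lt_top)), ← integral_const_mul]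
  refine integral_congr_ae (.of_forall fun x => ?_)
  simp only [ENNReal.toReal_mul, ENNReal.toReal_ofReal (h.levelWeight_nonneg i), smul_eq_mul,
    mul_assoc]

lemma measureReal_level_le (t : ℝ≥0) (i : ℕ) :
    P.real (s t ⁻¹' {some i}) ≤ levelWeight lam mu q p i := by
  have := isProbabilityMeasure_iidExp h.exit_level_pos i
  have hmeas := h.lintegral_levelTimes t i (g := 1) measurable_one
  simp only [Pi.one_apply, one_mul, setLIntegral_one] at hmeas
  refine ENNReal.toReal_le_of_le_ofReal (h.levelWeight_nonneg i) ?_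
  rw [hmeas]
  refine mul_le_of_le_one_right' ((lintegral_mono fun x => occupation_le_one P s {none} _).trans ?_)
  simp

variable (hloss : 0 < mu + lam * q * (1 - p))

include hloss

lemma tendsto_occupation_none : Tendsto (fun t => (occupation P s {none} t).toReal) atTop
    (𝓝 (steadyState lam mu q p none)) := by
  have hlim := h.tendsto_occupation_start rfl (c := mu + lam * q * (1 - p)) ?_ hloss
  · rwa [exitRate_none] at hlim
  · rintro (_ | i) hi
    exacts [absurd rfl hi, rfl]

lemma tendsto_measureReal_none :
    Tendsto (fun t => P.real {ω | s t ω = none}) atTop (𝓝 (steadyState lam mu q p none)) :=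
  ((h.tendsto_occupation_none hloss).comp (NNReal.tendsto_coe_atTop.2 tendsto_id)).congr fun t =>
    congrArg ENNReal.toReal (occupation_coe P s {none} t)

lemma tendsto_setIntegral_levelTimes (i : ℕ) {g : (Fin (i + 1) → ℝ) → ℝ} {C : ℝ}
    (hg : AEStronglyMeasurable g (iidExp (mu + lam * q) i))
    (hC : ∀ᵐ x ∂(iidExp (mu + lam * q) i), |g x| ≤ C) :
    Tendsto (fun t : ℝ≥0 => ∫ ω in s t ⁻¹' {some i}, g (levelTimes (fun u => s u ω) t i) ∂P)
      atTop (𝓝 (steadyState lam mu q p (some i) * ∫ x, g x ∂(iidExp (mu + lam * q) i))) := by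
  have := isProbabilityMeasure_iidExp h.exit_level_pos i
  have hocc := h.measurable_occupation (measurableSet_singleton none)
  simp only [h.setIntegral_levelTimes _ i hg, steadyState_some, mul_assoc]
  refine Tendsto.const_mul _ ?_
  rw [← integral_const_mul]
  refine tendsto_integral_filter_of_dominated_convergence (fun _ => C)
    (.of_forall fun t => ?_) (.of_forall fun t => ?_) (integrable_const C) (.of_forall fun x => ?_)
  · exact AEStronglyMeasurable.mul (Measurable.aestronglyMeasurable (by fun_prop)) hg
  · filter_upwards [hC] with x hx
    have hmem := toReal_occupation_mem_Icc P s {none} (t - ∑ j, x j)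
    rw [Real.norm_eq_abs, abs_mul, abs_of_nonneg hmem.1]
    exact (mul_le_of_le_one_left (abs_nonneg _) hmem.2).trans hx
  · exact ((h.tendsto_occupation_none hloss).comp
      (tendsto_atTop_add_const_right _ _ (NNReal.tendsto_coe_atTop.2 tendsto_id))).mul_const _

lemma tendsto_measureReal_some (i : ℕ) :
    Tendsto (fun t => P.real {ω | s t ω = some i}) atTop
      (𝓝 (steadyState lam mu q p (some i))) := by
  have := isProbabilityMeasure_iidExp h.exit_level_pos i
  have hlim := h.tendsto_setIntegral_levelTimes hloss i (g := 1) (C := 1)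
    aestronglyMeasurable_one (by simp)
  simp only [Pi.one_apply, integral_const, smul_eq_mul, mul_one, probReal_univ,
    measureReal_restrict_apply_univ] at hlim
  exact hlim

lemma tendsto_measureReal :
    ∀ x, Tendsto (fun t => P.real {ω | s t ω = x}) atTop (𝓝 (steadyState lam mu q p x))
  | none => h.tendsto_measureReal_none hloss
  | some i => h.tendsto_measureReal_some hloss i

lemma tendsto_integral_cond_levelTimes {i : ℕ} (hi : 0 < steadyState lam mu q p (some i))
    (g : BoundedContinuousFunction (Fin (i + 1) → ℝ) ℝ) :
    Tendsto (fun t => ∫ ω, g (levelTimes (fun u => s u ω) t i) ∂(P[|{ω | s t ω = some i}]))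
      atTop (𝓝 (∫ x, g x ∂(iidExp (mu + lam * q) i))) := by
  have hlim := ((h.tendsto_measureReal_some hloss i).inv₀ hi.ne').mul
    (h.tendsto_setIntegral_levelTimes hloss i g.continuous.aestronglyMeasurable
      (.of_forall g.norm_coe_le_norm))
  rw [inv_mul_cancel_left₀ hi.ne'] at hlim
  exact hlim.congr fun t => (integral_cond P _ _).symm

end IsJumpProcess

end Climb

/-! ### Consumed fidelity -/

section Fidelity

lemma re_star_dotProduct_mulVec (ρ : TwoQubit) (c : Fin 2 → ℝ) :
    (star (fun x : Fin 2 × Fin 2 => if x.1 = x.2 then (c x.1 : ℂ) else 0) ⬝ᵥ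
      ρ *ᵥ fun x => if x.1 = x.2 then (c x.1 : ℂ) else 0).re =
        ∑ a, ∑ b, c a * c b * (ρ (a, a) (b, b)).re := by
  simp only [dotProduct, Pi.star_apply, RCLike.star_def, Matrix.mulVec, mul_ite, mul_zero,
    Fintype.sum_prod_type, Finset.sum_ite_eq, Finset.mem_univ, if_true, Fin.sum_univ_two,
    Complex.conj_ofReal, zero_ne_one, if_false, map_zero, zero_mul, add_zero, one_ne_zero, zero_add,
    Complex.add_re, Complex.mul_re, Complex.ofReal_re, Complex.ofReal_im, sub_zero, Complex.add_im,
    Complex.mul_im]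
  ring

-- The upper bound combines `tr ρ = 1` with positivity of `ρ` at `|01⟩`, at `|10⟩` and at the Bell
-- state `(|00⟩ - |11⟩) / √2`.
lemma fidelity_mem_Icc {ρ : TwoQubit} (hρ : IsState ρ) : fidelity ρ ∈ Icc (0 : ℝ) 1 := by
  obtain ⟨hpos, htrace⟩ := hρ
  have hform_nonneg : ∀ v : Fin 2 × Fin 2 → ℂ, 0 ≤ (star v ⬝ᵥ ρ *ᵥ v).re := fun v =>
    (Complex.le_def.1 (hpos.dotProduct_mulVec_nonneg v)).1
  have hdiag_nonneg : ∀ x, 0 ≤ (ρ x x).re := fun x => (Complex.le_def.1 hpos.diag_nonneg).1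
  have hplus : fidelity ρ = ∑ a : Fin 2, ∑ b : Fin 2, (√2)⁻¹ * (√2)⁻¹ * (ρ (a, a) (b, b)).re :=
    re_star_dotProduct_mulVec ρ fun _ => (√2)⁻¹
  have hsqrt : (√2)⁻¹ * (√2)⁻¹ = (1 / 2 : ℝ) := by
    rw [← mul_inv, Real.mul_self_sqrt zero_le_two, one_div]
  have hminus := (hform_nonneg _).trans_eq (re_star_dotProduct_mulVec ρ ![1, -1])
  have htrace_re : ∑ a : Fin 2, ∑ b : Fin 2, (ρ (a, b) (a, b)).re = 1 := by
    simpa [Matrix.trace, Fintype.sum_prod_type] using congrArg Complex.re htrace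
  refine ⟨hform_nonneg phiPlus, ?_⟩
  simp only [Fin.sum_univ_two, hsqrt, Matrix.cons_val_zero, Matrix.cons_val_one]
    at hplus hminus htrace_re
  linarith [hdiag_nonneg (0, 1), hdiag_nonneg (1, 0)]

lemma depol_mem_Icc {Γ t F : ℝ} (hΓ : 0 ≤ Γ) (ht : 0 ≤ t) (hF : F ∈ Icc (0 : ℝ) 1) :
    depol Γ t F ∈ Icc (0 : ℝ) 1 := by
  have hexp_pos := Real.exp_pos (-(Γ * t))
  have hexp_le : Real.exp (-(Γ * t)) ≤ 1 :=
    Real.exp_le_one_iff.2 (neg_nonpos.2 (mul_nonneg hΓ ht))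
  have hconvex : depol Γ t F =
      Real.exp (-(Γ * t)) * F + (1 - Real.exp (-(Γ * t))) * (1 / 4) := by
    rw [depol]
    ring
  rw [hconvex]
  constructor <;> nlinarith [hF.1, hF.2]

lemma levelTimes_nonneg (f : ℝ≥0 → Option ℕ) (t : ℝ≥0) (i : ℕ) : 0 ≤ levelTimes f t i := fun _ =>
  sub_nonneg.2 (NNReal.coe_le_coe.2
    (csInf_le (OrderBot.bddBelow _) ⟨le_rfl, fun _ hv hv' => absurd hv hv'.not_ge⟩))

variable {Γ : ℝ} {J : ℝ → TwoQubit → ℝ} {ρ : TwoQubit}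

lemma pathFidelity_of_eq_some {f : ℝ≥0 → Option ℕ} {t : ℝ≥0} {i : ℕ} (h : f t = some i) :
    pathFidelity Γ J ρ f t = levelFidelity Γ J ρ i (levelTimes f t i) := by
  simp only [pathFidelity, h]

lemma pathFidelity_of_eq_none {f : ℝ≥0 → Option ℕ} {t : ℝ≥0} (h : f t = none) :
    pathFidelity Γ J ρ f t = 0 := by
  simp only [pathFidelity, h]

variable (hΓ : 0 ≤ Γ) (hF : fidelity ρ ∈ Icc (0 : ℝ) 1)
  (hJ : ∀ F ∈ Icc (0 : ℝ) 1, J F ρ ∈ Icc (0 : ℝ) 1)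

include hΓ hF hJ

lemma levelFidelity_mem_Icc (i : ℕ) {x : Fin (i + 1) → ℝ} (hx : 0 ≤ x) :
    levelFidelity Γ J ρ i x ∈ Icc (0 : ℝ) 1 := by
  induction i with
  | zero => exact depol_mem_Icc hΓ (hx 0) hF
  | succ i ih => exact depol_mem_Icc hΓ (hx _) (hJ _ (ih fun j => hx j.castSucc))

lemma pathFidelity_mem_Icc (f : ℝ≥0 → Option ℕ) (t : ℝ≥0) :
    pathFidelity Γ J ρ f t ∈ Icc (0 : ℝ) 1 := by
  rcases hf : f t with _ | i
  · rw [pathFidelity_of_eq_none hf]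
    exact ⟨le_rfl, zero_le_one⟩
  · rw [pathFidelity_of_eq_some hf]
    exact levelFidelity_mem_Icc hΓ hF hJ i (levelTimes_nonneg f t i)

lemma ae_levelFidelity_mem_Icc {a : ℝ} (ha : 0 < a) (i : ℕ) :
    ∀ᵐ x ∂(iidExp a i), levelFidelity Γ J ρ i x ∈ Icc (0 : ℝ) 1 :=
  (ae_iidExp_nonneg ha i).mono fun _ => levelFidelity_mem_Icc hΓ hF hJ i

variable (hJc : ContinuousOn (fun F => J F ρ) (Icc 0 1))

include hJc

lemma continuousOn_levelFidelity (i : ℕ) : ContinuousOn (levelFidelity Γ J ρ i) (Ici 0) := by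
  induction i with
  | zero =>
    change ContinuousOn
      (fun x : Fin 1 → ℝ => Real.exp (-(Γ * x 0)) * (fidelity ρ - 1 / 4) + 1 / 4) _
    fun_prop
  | succ i ih =>
    have hprev : ContinuousOn (fun x : Fin (i + 2) → ℝ =>
        J (levelFidelity Γ J ρ i fun j => x j.castSucc) ρ) (Ici 0) :=
      hJc.comp (ih.comp (by fun_prop) fun x hx j => hx j.castSucc)
        fun x hx => levelFidelity_mem_Icc hΓ hF hJ i fun j => hx j.castSucc
    exact ContinuousOn.add (ContinuousOn.mul (by fun_prop) (hprev.sub continuousOn_const))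
      continuousOn_const

lemma aestronglyMeasurable_levelFidelity {a : ℝ} (ha : 0 < a) (i : ℕ) :
    AEStronglyMeasurable (levelFidelity Γ J ρ i) (iidExp a i) := by
  rw [← Measure.restrict_eq_self_of_ae_mem (s := Ici 0) (ae_iidExp_nonneg ha i)]
  exact (continuousOn_levelFidelity hΓ hF hJ hJc i).aestronglyMeasurable measurableSet_Ici

lemma integrable_levelFidelity {a : ℝ} (ha : 0 < a) (i : ℕ) :
    Integrable (levelFidelity Γ J ρ i) (iidExp a i) :=
  have := isProbabilityMeasure_iidExp ha i
  .of_mem_Icc 0 1 (aestronglyMeasurable_levelFidelity hΓ hF hJ hJc ha i).aemeasurable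
    (ae_levelFidelity_mem_Icc hΓ hF hJ ha i)

end Fidelity

section Consumption

variable {lam mu q p Γ : ℝ} {J : ℝ → TwoQubit → ℝ} {ρ : TwoQubit} {Ω : Type*} [MeasurableSpace Ω]
  {P : Measure Ω} [IsProbabilityMeasure P] {s : ℝ≥0 → Ω → Option ℕ} {Y : ℕ → Ω → Option ℕ}
  {H : ℕ → Ω → ℝ} (h : IsJumpProcess P (rate lam mu q p) none s Y H) (hΓ : 0 ≤ Γ)
  (hF : fidelity ρ ∈ Icc (0 : ℝ) 1) (hJ : ∀ F ∈ Icc (0 : ℝ) 1, J F ρ ∈ Icc (0 : ℝ) 1)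

namespace IsJumpProcess

include h hΓ hF hJ

lemma norm_setIntegral_pathFidelity_le (t : ℝ≥0) (i : ℕ) :
    ‖∫ ω in s t ⁻¹' {some i}, pathFidelity Γ J ρ (fun u => s u ω) t ∂P‖ ≤
      levelWeight lam mu q p i := by
  refine (norm_setIntegral_le_of_norm_le_const (C := 1) (measure_lt_top _ _) fun ω _ => ?_).trans ?_
  · have hmem := pathFidelity_mem_Icc hΓ hF hJ (fun u => s u ω) t
    rw [Real.norm_of_nonneg hmem.1]
    exact hmem.2
  · rw [one_mul]
    exact h.measureReal_level_le t i

variable (hJc : ContinuousOn (fun F => J F ρ) (Icc 0 1))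

include hJc

lemma integrable_pathFidelity (t : ℝ≥0) :
    Integrable (fun ω => pathFidelity Γ J ρ (fun u => s u ω) t) P := by
  have hstate : ∀ x, MeasurableSet (s t ⁻¹' {x}) := fun x =>
    h.measurable_process t (measurableSet_singleton x)
  refine .of_mem_Icc 0 1 ?_ (.of_forall fun ω => pathFidelity_mem_Icc hΓ hF hJ _ t)
  rw [← Measure.restrict_univ (μ := P), ← preimage_univ (f := s t),
    ← iUnion_of_singleton (Option ℕ), preimage_iUnion, aemeasurable_iUnion_iff]
  rintro (_ | i)
  · refine (aemeasurable_const (b := (0 : ℝ))).congr ?_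
    filter_upwards [ae_restrict_mem (hstate none)] with ω hω
    exact (pathFidelity_of_eq_none (mem_singleton_iff.1 hω)).symm
  · have hlevel := (aestronglyMeasurable_levelFidelity hΓ hF hJ hJc h.exit_level_pos i).mono_ac
      (h.map_levelTimes_absolutelyContinuous t i)
    refine (hlevel.aemeasurable.comp_aemeasurable (h.aemeasurable_levelTimes t i)).congr ?_
    filter_upwards [ae_restrict_mem (hstate (some i))] with ω hω
    exact (pathFidelity_of_eq_some (mem_singleton_iff.1 hω)).symm

lemma setIntegral_pathFidelity_eq_tsum (t : ℝ≥0) :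
    ∫ ω in {ω | s t ω ≠ none}, pathFidelity Γ J ρ (fun u => s u ω) t ∂P =
      ∑' i, ∫ ω in s t ⁻¹' {some i}, pathFidelity Γ J ρ (fun u => s u ω) t ∂P := by
  have hunion : {ω | s t ω ≠ none} = ⋃ i, s t ⁻¹' {some i} := by
    ext ω
    simp [Option.ne_none_iff_exists']
  rw [hunion]
  refine integral_iUnion (fun i => h.measurable_process t (measurableSet_singleton _))
    (fun i j hij => ?_) (h.integrable_pathFidelity hΓ hF hJ hJc t).integrableOn
  exact (disjoint_singleton.2 fun hsome => hij (Option.some.inj hsome)).preimage (s t)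

variable (hloss : 0 < mu + lam * q * (1 - p))

include hloss

lemma tendsto_setIntegral_pathFidelity (i : ℕ) :
    Tendsto (fun t => ∫ ω in s t ⁻¹' {some i}, pathFidelity Γ J ρ (fun u => s u ω) t ∂P) atTop
      (𝓝 ((∫ x, levelFidelity Γ J ρ i x ∂(iidExp (mu + lam * q) i)) *
        steadyState lam mu q p (some i))) := by
  have hbound := (ae_levelFidelity_mem_Icc (Γ := Γ) hΓ hF hJ h.exit_level_pos i).mono fun x hx =>
    abs_le.2 ⟨by linarith [hx.1], hx.2⟩
  rw [mul_comm]
  refine (h.tendsto_setIntegral_levelTimes hloss i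
    (aestronglyMeasurable_levelFidelity hΓ hF hJ hJc h.exit_level_pos i) hbound).congr fun t => ?_
  exact setIntegral_congr_fun (h.measurable_process t (measurableSet_singleton _))
    fun ω (hω : s t ω = some i) => (pathFidelity_of_eq_some hω).symm

lemma summable_levelFidelity :
    Summable fun i => (∫ x, levelFidelity Γ J ρ i x ∂(iidExp (mu + lam * q) i)) *
      steadyState lam mu q p (some i) :=
  .of_norm_bounded (h.summable_levelWeight hloss) fun i =>
    le_of_tendsto (h.tendsto_setIntegral_pathFidelity hΓ hF hJ hJc hloss i).norm
      (.of_forall fun t => h.norm_setIntegral_pathFidelity_le hΓ hF hJ t i)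

lemma tendsto_integral_cond_pathFidelity :
    Tendsto (fun t => ∫ ω, pathFidelity Γ J ρ (fun u => s u ω) t ∂(P[|{ω | s t ω ≠ none}])) atTop
      (𝓝 (1 / (1 - steadyState lam mu q p none) *
        ∑' i, (∫ x, levelFidelity Γ J ρ i x ∂(iidExp (mu + lam * q) i)) *
          steadyState lam mu q p (some i))) := by
  have hcompl : ∀ t, 1 - P.real {ω | s t ω = none} = P.real {ω | s t ω ≠ none} := fun t =>
    (probReal_compl_eq_one_sub (h.measurable_process t (measurableSet_singleton none))).symm
  have hlink : Tendsto (fun t => P.real {ω | s t ω ≠ none}) atTop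
      (𝓝 (1 - steadyState lam mu q p none)) :=
    ((h.tendsto_measureReal hloss none).const_sub 1).congr hcompl
  simp only [integral_cond, h.setIntegral_pathFidelity_eq_tsum hΓ hF hJ hJc, one_div]
  exact (hlink.inv₀ (sub_pos.2 (steadyState_none_lt_one h.lam_pos hloss)).ne').mul
    (tendsto_tsum_of_dominated_convergence (h.summable_levelWeight hloss)
      (h.tendsto_setIntegral_pathFidelity hΓ hF hJ hJc hloss)
      (.of_forall (h.norm_setIntegral_pathFidelity_le hΓ hF hJ)))

end IsJumpProcess

end Consumption

end Buffer

theorem theorem1_general {Ω : Type*} [MeasurableSpace Ω] (P : Measure Ω) [IsProbabilityMeasure P]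
    (lam mu q p Γ : ℝ) (hlam : 0 < lam) (hqp : 0 ≤ lam * q * p)
    (hloss : 0 < mu + lam * q * (1 - p)) (hΓ : 0 ≤ Γ)
    (ρnew : Buffer.TwoQubit) (hF : Buffer.fidelity ρnew ∈ Set.Icc (0 : ℝ) 1)
    (J : ℝ → Buffer.TwoQubit → ℝ)
    (hJcont : ContinuousOn (fun F => J F ρnew) (Set.Icc 0 1))
    (hJmaps : ∀ F ∈ Set.Icc (0 : ℝ) 1, J F ρnew ∈ Set.Icc (0 : ℝ) 1)
    (s : ℝ≥0 → Ω → Option ℕ) (hs : Buffer.Is1G1B P lam mu q p s) :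
    ∃ π : Option ℕ → ℝ,
      (∀ x, Tendsto (fun t => P.real {ω | s t ω = x}) atTop (𝓝 (π x))) ∧
      0 < 1 - π none ∧
      (∀ t, Integrable (fun ω => Buffer.pathFidelity Γ J ρnew (fun u => s u ω) t) P) ∧
      (∀ i : ℕ, 0 < π (some i) → ∀ g : BoundedContinuousFunction (Fin (i + 1) → ℝ) ℝ,
        Tendsto (fun t => ∫ ω, g (Buffer.levelTimes (fun u => s u ω) t i)
            ∂(P[|{ω | s t ω = some i}]))
          atTop (𝓝 (∫ x, g x ∂(Buffer.iidExp (mu + lam * q) i)))) ∧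
      (∀ i : ℕ, Integrable (Buffer.levelFidelity Γ J ρnew i) (Buffer.iidExp (mu + lam * q) i)) ∧
      Summable (fun i : ℕ =>
        (∫ x, Buffer.levelFidelity Γ J ρnew i x ∂(Buffer.iidExp (mu + lam * q) i)) *
          π (some i)) ∧
      Tendsto (fun t => ∫ ω, Buffer.pathFidelity Γ J ρnew (fun u => s u ω) t
          ∂(P[|{ω | s t ω ≠ none}]))
        atTop
        (𝓝 (1 / (1 - π none) * ∑' i : ℕ,
          (∫ x, Buffer.levelFidelity Γ J ρnew i x ∂(Buffer.iidExp (mu + lam * q) i)) *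
            π (some i))) := by
  open Buffer in
  obtain ⟨Y, H, h⟩ := IsCTMC.exists_isJumpProcess hs (M := max lam (mu + lam * q))
    (rate_nonneg hlam.le hqp hloss.le)
    (fun
      | none => by rwa [exitRate_none]
      | some i => by rw [exitRate_some]; linarith)
    (fun
      | none => exitRate_none.trans_le (le_max_left _ _)
      | some i => (exitRate_some i).trans_le (le_max_right _ _))
  exact ⟨steadyState lam mu q p, h.tendsto_measureReal hloss,
    sub_pos.2 (steadyState_none_lt_one hlam hloss),
    h.integrable_pathFidelity hΓ hF hJmaps hJcont,
    fun i hi g => h.tendsto_integral_cond_levelTimes hloss hi g,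
    integrable_levelFidelity hΓ hF hJmaps hJcont h.exit_level_pos,
    h.summable_levelFidelity hΓ hF hJmaps hJcont hloss,
    h.tendsto_integral_cond_pathFidelity hΓ hF hJmaps hJcont hloss⟩

theorem theorem1 {Ω : Type*} [MeasurableSpace Ω] (P : Measure Ω) [IsProbabilityMeasure P]
    (lam mu q p Γ : ℝ) (hlam : 0 < lam) (hmu : 0 ≤ mu)
    (hq : q ∈ Set.Icc (0 : ℝ) 1) (hp : p ∈ Set.Icc (0 : ℝ) 1)
    (hloss : 0 < mu + lam * q * (1 - p)) (hΓ : 0 ≤ Γ)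
    (ρnew : Buffer.TwoQubit) (hρ : Buffer.IsState ρnew)
    (J : ℝ → Buffer.TwoQubit → ℝ)
    (hJcont : ContinuousOn (fun F => J F ρnew) (Set.Icc 0 1))
    (hJmaps : ∀ F ∈ Set.Icc (0 : ℝ) 1, J F ρnew ∈ Set.Icc (0 : ℝ) 1)
    (s : ℝ≥0 → Ω → Option ℕ) (hs : Buffer.Is1G1B P lam mu q p s) :
    ∃ π : Option ℕ → ℝ,
      -- `π` is the steady-state distribution, and the availability `1 - π none` is positive
      (∀ x, Tendsto (fun t => P.real {ω | s t ω = x}) atTop (𝓝 (π x))) ∧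
      0 < 1 - π none ∧
      (∀ t, Integrable (fun ω => Buffer.pathFidelity Γ J ρnew (fun u => s u ω) t) P) ∧
      -- given level `i`, the level times converge in distribution to i.i.d. exponentials
      (∀ i : ℕ, 0 < π (some i) → ∀ g : BoundedContinuousFunction (Fin (i + 1) → ℝ) ℝ,
        Tendsto (fun t => ∫ ω, g (Buffer.levelTimes (fun u => s u ω) t i)
            ∂(P[|{ω | s t ω = some i}]))
          atTop (𝓝 (∫ x, g x ∂(Buffer.iidExp (mu + lam * q) i)))) ∧
      -- the average consumed fidelity
      (∀ i : ℕ, Integrable (Buffer.levelFidelity Γ J ρnew i) (Buffer.iidExp (mu + lam * q) i)) ∧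
      Summable (fun i : ℕ =>
        (∫ x, Buffer.levelFidelity Γ J ρnew i x ∂(Buffer.iidExp (mu + lam * q) i)) *
          π (some i)) ∧
      Tendsto (fun t => ∫ ω, Buffer.pathFidelity Γ J ρnew (fun u => s u ω) t
          ∂(P[|{ω | s t ω ≠ none}]))
        atTop
        (𝓝 (1 / (1 - π none) * ∑' i : ℕ,
          (∫ x, Buffer.levelFidelity Γ J ρnew i x ∂(Buffer.iidExp (mu + lam * q) i)) *
            π (some i))) :=
  theorem1_general P lam mu q p Γ hlam (mul_nonneg (mul_nonneg hlam.le hq.1) hp.1) hloss hΓ ρnew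
    (Buffer.fidelity_mem_Icc hρ) J hJcont hJmaps s hs
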